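/- **Setting.** Consider $M$ subsystems $i\in\mathcal M=\{1,\dots,M\}$ with states $x_i\in\mathbb R^{n_i}$, inputs $u_i\in\mathbb R^{m_i}$ and neighbourhoods $\mathcal N_i\subseteq\mathcal M\setminus\{i\}$ (the subsystems that affect $i$). For each $i$, the state constraint set $\mathcal X_i$ is convex and is the union of finitely many closed convex polyhedra $P_i^{(l)}$, $l\in\mathcal L_i$ (the regions), with pairwise disjoint interiors; $\mathcal U_i$ is closed and convex. The dynamics are $x_i^+=f_i(x_i,u_i,\{x_j\}_{j\in\mathcal N_i})$, where $f_i$ is a function satisfying $f_i=f_i^{(l)}$ whenever $x_i\in P_i^{(l)}$, for every $l$, with $$f_i^{(l)}(x_i,u_i,\{x_j\})=A_i^{(l)}x_i+B_i^{(l)}u_i+c_i^{(l)}+\sum_{j\in\mathcal N_i}A_{ij}^{(l)}x_j$$ (so the affine pieces agree where regions meet). Let $h_i(x_i,\{x_j\}_{j\in\mathcal N_i})\le 0$ be finitely many affine coupled constraints. **MPC problem.** Fix a horizon $N\ge1$, gains $K_i^{(l)}$, terminal sets $\mathcal X_{T,i}\subseteq\mathbb R^{n_i}$, and costs $\ell_i=x_i^\top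 Q_ix_i+u_i^\top R_iu_i+\sum_{j\in\mathcal N_i}x_j^\top Q_{ij}x_j$, $V_{f,i}=x_i^\top\Phi_ix_i$; put $\mathcal X_T=\prod_i\mathcal X_{T,i}$. A local variable $\mathbf y_i=(\tilde{\mathbf x}_i,\mathbf u_i)$ consists of $\tilde{\mathbf x}_i=(\mathbf x_i,(\mathbf x_j^{(i)})_{j\in\mathcal N_i})$, i.e. a predicted state trajectory $\mathbf x_i=(x_i(0),\dots,x_i(N))$ and copies $\mathbf x_j^{(i)}$ of the neighbours' trajectories, and of inputs $\mathbf u_i=(u_i(0),\dots,u_i(N-1))$. Its cost is $$F_i(\mathbf y_i)=\sum_{k<N}\ell_i(x_i(k),u_i(k),\{x_j^{(i)}(k)\})+V_{f,i}(x_i(N)).$$ Let $\mathcal Y_i(x_i)$ be the set of $\mathbf y_i$ with $x_i(0)=x_i$, $h_i(x_i(k),\{x_j^{(i)}(k)\})\le0$ and $x_i(k)\in\mathcal X_i$ for $0\le k\le N$, $u_i(k)\in\mathcal U_i$ for $0\le k<N$, and $x_i(N)\in\mathcal X_{T,i}$. For a switching sequence $s_i\in\mathcal L_i^{N+1}$ let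 $\mathcal Y_i^{(s_i)}$ be the set of $\mathbf y_i$ with $x_i(k)\in P_i^{(s_i(k))}$ for $0\le k\le N$ and $x_i(k+1)=f_i^{(s_i(k))}(x_i(k),u_i(k),\{x_j^{(i)}(k)\})$ for $0\le k<N$. Let $\mathcal Y(x)$ be the set of $\mathbf y=(\mathbf y_i)_i$ with $\mathbf y_i\in\mathcal Y_i(x_i)$, $x_i(k+1)=f_i(x_i(k),u_i(k),\{x^{(i)}_j(k)\})$ and $\mathbf x_j^{(i)}=\mathbf x_j$ for all $i$ and $j\in\mathcal N_i$; for $s=(s_1,\dots,s_M)$ let $\mathcal Y_s(x)$ be the set of $\mathbf y$ with $\mathbf y_i\in\mathcal Y_i(x_i)\cap\mathcal Y_i^{(s_i)}$ and $\mathbf x_j^{(i)}=\mathbf x_j$ for all $i$ and $j\in\mathcal N_i$. Put $\mathcal X_0=\{x:\mathcal Y(x)\ne\emptyset\}$. **Switching ADMM.** The *roll-out* $\mathbf y_{\mathrm{dr}}$ of input sequences $\hat{\mathbf u}$ from $x$ consists of $\hat{\mathbf u}$, the state trajectories that it produces under the true dynamics, and exact copies of these. Given $x_i$, the inputs and copies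 in $\mathbf y_i$ *generate* $s_i$ if the trajectory $\xi(0)=x_i$, $\xi(k+1)=f_i^{(s_i(k))}(\xi(k),u_i(k),\{x_j^{(i)}(k)\})$ satisfies $\xi(k)\in\overline{P}{}_i^{(s_i(k))}$ for $0\le k\le N$. The sequences $\hat{\mathbf u}$ are *weakly feasible* for $x$ if their roll-out generates at least one global sequence $s$ and $\mathcal Y_s(x)\neq\emptyset$ for every $s$ it generates. With $\rho>0$ and $T_{\rm cut}\in\mathbb N$, switching ADMM at $x$ with guess $\hat{\mathbf u}$ starts from $\mathbf z=0$, $\boldsymbol\lambda=0$ and any $s$ generated by the roll-out, and repeats for $\tau=0,1,\dots$ and all $i$: (i) $\mathbf y_i$ becomes a minimizer of $F_i(\mathbf y_i)+\boldsymbol\lambda_i^\top\tilde{\mathbf x}_i+\frac\rho2\|\tilde{\mathbf x}_i-\tilde{\mathbf z}_i\|_2^2$ over $\mathcal Y_i(x_i)\cap\mathcal Y_i^{(s_i)}$, where $\tilde{\mathbf z}_i=(\mathbf z_i,(\mathbf z_j)_{j\in\mathcal N_i})$; (ii) $\mathbf z_i$ becomes the average of $\mathbf x_i$ and all copies $\mathbf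 x_i^{(j)}$, $i\in\mathcal N_j$; (iii) $\boldsymbol\lambda_i$ increases by $\rho(\tilde{\mathbf x}_i-\tilde{\mathbf z}_i)$; (iv) if $\tau<T_{\rm cut}$ and $\mathbf y_i$ generates a sequence other than $s_i$, then $s_i$ is replaced by such a sequence. The output is the limit of $\mathbf y$ as the number of iterations tends to infinity. **Controller.** At each time step with state $x$: if $x\in\mathcal X_T$, apply $u_i=K_i^{(l)}x_i$ with some $l$ such that $x_i\in P_i^{(l)}$. Otherwise take a guess $\hat{\mathbf u}$: a given one at the first time step, and afterwards $\hat{\mathbf u}_i=(\bar u_i(1),\dots,\bar u_i(N-1),K_i^{(l)}\bar x_i(N))$ with $\bar x_i(N)\in P_i^{(l)}$, where $\bar{\mathbf x},\bar{\mathbf u}$ is the previous plan. Run switching ADMM; its output is the plan $\mathbf y$, except that if the roll-out satisfies $\mathbf y_{\mathrm{dr}}\in\mathcal Y(x)$ and $F_i(\mathbf y_i)\le F_i(\mathbf y_{i,\mathrm{dr}})$ fails for some $i$, then the plan is $\mathbf y_{\mathrm{dr}}$. Apply the first inputs $u_i(0)$ of the plan. **Assumptions.** 1. For every $x\in\mathcal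 X_0$ there is no $s$ with $\mathcal Y_s(x)=\emptyset$ and $\mathcal Y_i(x_i)\cap\mathcal Y_i^{(s_i)}\ne\emptyset$ for all $i$. 2. The number of ADMM iterations tends to infinity (the output is the limit, as above). 3. All pairs $(A_i^{(l)},B_i^{(l)})$ are controllable, all $A_i^{(l)}+B_i^{(l)}K_i^{(l)}$ are Schur, and $c_i^{(l)}=0$ for all $l\in\hat{\mathcal L}_i:=\{l:0\in\overline{P}{}_i^{(l)}\}$. 4. $\mathcal X_{T,i}\subseteq\bigcup_{l\in\hat{\mathcal L}_i}P_i^{(l)}$ is closed and contains a neighbourhood of $0$ relative to $\mathcal X_i$. For all $x_i\in\mathcal X_{T,i}\cap P_i^{(l)}$ we have $K_i^{(l)}x_i\in\mathcal U_i$, and $f_i(x_i,K_i^{(l)}x_i,\{x_j\})\in\mathcal X_{T,i}$ whenever $x_j\in\mathcal X_{T,j}$ for all $j\in\mathcal N_i$. If $x\in\mathcal X_T$ satisfies the coupled constraints, so does its successor under $u_i=K_i^{(l_i)}x_i$, for all $l_i$ with $x_i\in P_i^{(l_i)}$. 5. $Q_i,R_i,\Phi_i$ are positive definite, $Q_{ij}$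 is positive semidefinite, and for all $x\in\mathcal X_T$ and all $l_i$ with $x_i\in P_i^{(l_i)}$, with $u_i=K_i^{(l_i)}x_i$, $$\sum_{i\in\mathcal M}\Big(V_{f,i}\big(f_i(x_i,u_i,\{x_j\})\big)-V_{f,i}(x_i)+\ell_i(x_i,u_i,\{x_j\})\Big)\le0.$$ 6. For an initial state outside $\mathcal X_T$, the given first guess is weakly feasible. **Theorem.** Under Assumptions 1–6 the controller is exponentially stabilizing with region of attraction $\mathcal X_0$: there is $\gamma\in(0,1)$ such that * there are $\delta>0$ and $C$ with $\|x(t)\|\le C\gamma^t\|x(0)\|$ for all $t\ge0$ and all closed-loop trajectories with $x(0)\in\mathcal X_0$, $\|x(0)\|<\delta$; * for every closed-loop trajectory with $x(0)\in\mathcal X_0$ there is $C$ with $\|x(t)\|\le C\gamma^t\|x(0)\|$ for all $t\ge0$; * if all $\mathcal X_i$ and $\mathcal U_i$ are bounded, one constant $C$ serves all closed-loop trajectories with $x(0)\in\mathcal X_0$. Moreover, if all $\mathcal U_i$ and $\mathcal X_{T,i}$ are polyhedra, the control law is well defined: from every initial state in $\mathcal X_0$ the closed loop never gets stuck, and every execution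 of switching ADMM that occurs in it converges. -/

import Mathlib

open Filter Topology Matrix

noncomputable section

/-- A (closed, possibly unbounded) polyhedron: finitely many affine inequalities `G x ≤ g`. -/
def IsPolyhedron {n : ℕ} (T : Set (Fin n → ℝ)) : Prop :=
  ∃ (q : ℕ) (G : Matrix (Fin q) (Fin n) ℝ) (g : Fin q → ℝ), T = {x | G *ᵥ x ≤ g}

/-- A matrix pair is controllable: the columns of `B, A B, …, A^(n-1) B` span the state space. -/
def IsControllablePair {n m : ℕ} (A : Matrix (Fin n) (Fin n) ℝ) (B : Matrix (Fin n) (Fin m) ℝ) :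
    Prop :=
  Submodule.span ℝ {v : Fin n → ℝ | ∃ k < n, ∃ w : Fin m → ℝ, v = (A ^ k * B) *ᵥ w} = ⊤

/-- A real square matrix is Schur: all its complex eigenvalues lie in the open unit disc. -/
def IsSchur {n : ℕ} (A : Matrix (Fin n) (Fin n) ℝ) : Prop :=
  ∀ μ ∈ spectrum ℂ (A.map (algebraMap ℝ ℂ)), ‖μ‖ < 1

/-- A network of `M` coupled piecewise affine (PWA) subsystems with constraints. -/
structure PWANetwork (M : ℕ) where
  /-- state dimensions -/
  n : Fin M → ℕ
  /-- input dimensions -/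
  m : Fin M → ℕ
  /-- `nbr i` is the neighbourhood of `i`: the subsystems that affect `i` -/
  nbr : Fin M → Finset (Fin M)
  not_mem_nbr : ∀ i, i ∉ nbr i
  /-- numbers of PWA regions -/
  L : Fin M → ℕ
  /-- PWA regions -/
  P : ∀ i, Fin (L i) → Set (Fin (n i) → ℝ)
  isPolyhedron_P : ∀ i l, IsPolyhedron (P i l)
  disjoint_interior : ∀ i l l', l ≠ l' → Disjoint (interior (P i l)) (interior (P i l'))
  /-- state constraint sets -/
  X : ∀ i, Set (Fin (n i) → ℝ)
  convex_X : ∀ i, Convex ℝ (X i)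
  iUnion_P : ∀ i, ⋃ l, P i l = X i
  /-- input constraint sets -/
  U : ∀ i, Set (Fin (m i) → ℝ)
  convex_U : ∀ i, Convex ℝ (U i)
  isClosed_U : ∀ i, IsClosed (U i)
  A : ∀ i, Fin (L i) → Matrix (Fin (n i)) (Fin (n i)) ℝ
  B : ∀ i, Fin (L i) → Matrix (Fin (n i)) (Fin (m i)) ℝ
  c : ∀ i, Fin (L i) → (Fin (n i) → ℝ)
  /-- coupling matrices `A_ij`, for `j` in the neighbourhood of `i` -/
  Ac : ∀ i, Fin (L i) → ∀ j : nbr i, Matrix (Fin (n i)) (Fin (n j)) ℝ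
  /-- the state update functions; their values outside the state constraint set are arbitrary -/
  f : ∀ i, (Fin (n i) → ℝ) → (Fin (m i) → ℝ) → (∀ j : nbr i, Fin (n j) → ℝ) → (Fin (n i) → ℝ)
  f_eq : ∀ i l x u xn, x ∈ P i l →
    f i x u xn = A i l *ᵥ x + B i l *ᵥ u + c i l + ∑ j, Ac i l j *ᵥ xn j
  /-- numbers of scalar coupled constraints -/
  p : Fin M → ℕ
  /-- coefficients of the coupled constraints `H_i x_i + ∑ j, H_ij x_j + h0_i ≤ 0` -/
  H : ∀ i, Matrix (Fin (p i)) (Fin (n i)) ℝ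
  Hc : ∀ i, ∀ j : nbr i, Matrix (Fin (p i)) (Fin (n j)) ℝ
  h0 : ∀ i, Fin (p i) → ℝ

namespace PWANetwork

variable {M : ℕ} (S : PWANetwork M)

/-- Local states, local inputs, global states and global inputs. -/
abbrev St (i : Fin M) : Type := Fin (S.n i) → ℝ
abbrev Inp (i : Fin M) : Type := Fin (S.m i) → ℝ
abbrev State : Type := ∀ i, S.St i
abbrev Input : Type := ∀ i, S.Inp i

/-- The affine dynamics `f_i^(l)` of region `l`, used also outside that region. -/
def aff (i : Fin M) (l : Fin (S.L i)) (x : S.St i) (u : S.Inp i) (xn : ∀ j : S.nbr i, S.St j) :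
    S.St i :=
  S.A i l *ᵥ x + S.B i l *ᵥ u + S.c i l + ∑ j, S.Ac i l j *ᵥ xn j

/-- The coupled constraint functions `h_i`. -/
def h (i : Fin M) (x : S.St i) (xn : ∀ j : S.nbr i, S.St j) : Fin (S.p i) → ℝ :=
  S.H i *ᵥ x + ∑ j, S.Hc i j *ᵥ xn j + S.h0 i

/-- The states of the neighbours of `i` in a global state. -/
def nbrState (x : S.State) (i : Fin M) : ∀ j : S.nbr i, S.St j := fun j => x j

/-- One step of the true network dynamics. -/
def next (x : S.State) (u : S.Input) : S.State := fun i => S.f i (x i) (u i) (S.nbrState x i)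

end PWANetwork

/-- The design data of the distributed MPC controller for the network `S`. -/
structure MPCDesign {M : ℕ} (S : PWANetwork M) where
  /-- prediction horizon -/
  N : ℕ
  N_pos : 0 < N
  /-- weights of the stage and terminal costs -/
  Q : ∀ i, Matrix (Fin (S.n i)) (Fin (S.n i)) ℝ
  R : ∀ i, Matrix (Fin (S.m i)) (Fin (S.m i)) ℝ
  Qc : ∀ i, ∀ j : S.nbr i, Matrix (Fin (S.n j)) (Fin (S.n j)) ℝ
  Φ : ∀ i, Matrix (Fin (S.n i)) (Fin (S.n i)) ℝ
  /-- gains of the terminal controllers -/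
  K : ∀ i, Fin (S.L i) → Matrix (Fin (S.m i)) (Fin (S.n i)) ℝ
  /-- local terminal sets -/
  XT : ∀ i, Set (S.St i)
  /-- ADMM penalty parameter -/
  ρ : ℝ
  ρ_pos : 0 < ρ
  /-- number of ADMM iterations after which the switching sequences are frozen -/
  Tcut : ℕ

namespace MPCDesign

variable {M : ℕ} {S : PWANetwork M} (D : MPCDesign S)

/-! ### Costs and predicted trajectories -/

/-- Stage cost. -/
def stage (i : Fin M) (x : S.St i) (u : S.Inp i) (xn : ∀ j : S.nbr i, S.St j) : ℝ :=
  x ⬝ᵥ D.Q i *ᵥ x + u ⬝ᵥ D.R i *ᵥ u + ∑ j, xn j ⬝ᵥ D.Qc i j *ᵥ xn j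

/-- Terminal cost. -/
def Vf (i : Fin M) (x : S.St i) : ℝ := x ⬝ᵥ D.Φ i *ᵥ x

/-- Local state trajectories over the horizon, local input sequences, augmented trajectories
(own trajectory and copies of the trajectories of the neighbours), local decision variables
`y_i`, and global decision variables `y`. -/
abbrev Traj (i : Fin M) : Type := Fin (D.N + 1) → S.St i
abbrev InpSeq (i : Fin M) : Type := Fin D.N → S.Inp i
abbrev Aug (i : Fin M) : Type := D.Traj i × (∀ j : S.nbr i, D.Traj j)
abbrev LocVar (i : Fin M) : Type := D.Aug i × D.InpSeq i
abbrev Var : Type := ∀ i, D.LocVar i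

/-- Local switching sequences. -/
abbrev SwSeq (i : Fin M) : Type := Fin (D.N + 1) → Fin (S.L i)

variable {D}

/-- Own state trajectory `x_i` in a local decision variable. -/
def LocVar.own {i : Fin M} (y : D.LocVar i) : D.Traj i := y.1.1

/-- Local copy `x_j^(i)` of the trajectory of the neighbour `j`. -/
def LocVar.copy {i : Fin M} (y : D.LocVar i) (j : S.nbr i) : D.Traj j := y.1.2 j

/-- Input sequence `u_i` in a local decision variable. -/
def LocVar.inp {i : Fin M} (y : D.LocVar i) : D.InpSeq i := y.2

variable (D)

/-- Local cost `F_i` over the horizon. -/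
def cost (i : Fin M) (y : D.LocVar i) : ℝ :=
  ∑ k : Fin D.N,
    D.stage i (LocVar.own y k.castSucc) (LocVar.inp y k) (fun j => LocVar.copy y j k.castSucc)
  + D.Vf i (LocVar.own y (Fin.last D.N))

/-! ### Feasible sets -/

/-- Local constraints independent of the switching sequence, with the terminal constraint. -/
def localSet (i : Fin M) (xi : S.St i) : Set (D.LocVar i) :=
  {y | (∀ k, S.h i (LocVar.own y k) (fun j => LocVar.copy y j k) ≤ 0) ∧
    (∀ k, LocVar.own y k ∈ S.X i) ∧ (∀ k, LocVar.inp y k ∈ S.U i) ∧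
    LocVar.own y 0 = xi ∧ LocVar.own y (Fin.last D.N) ∈ D.XT i}

/-- Local constraints imposed by the switching sequence `s_i`. -/
def switchSet (i : Fin M) (s : D.SwSeq i) : Set (D.LocVar i) :=
  {y | (∀ k : Fin D.N, LocVar.own y k.succ =
      S.aff i (s k.castSucc) (LocVar.own y k.castSucc) (LocVar.inp y k)
        (fun j => LocVar.copy y j k.castSucc)) ∧
    ∀ k, LocVar.own y k ∈ S.P i (s k)}

/-- All local copies agree with the trajectories they copy. -/
def Consistent (y : D.Var) : Prop :=
  ∀ i, ∀ j : S.nbr i, LocVar.copy (y i) j = LocVar.own (y j)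

/-- The feasible set `Y(x)` of the distributed MPC problem. -/
def feasible (x : S.State) : Set D.Var :=
  {y | (∀ i, y i ∈ D.localSet i (x i)) ∧
    (∀ i, ∀ k : Fin D.N, LocVar.own (y i) k.succ =
      S.f i (LocVar.own (y i) k.castSucc) (LocVar.inp (y i) k)
        (fun j => LocVar.copy (y i) j k.castSucc)) ∧
    D.Consistent y}

/-- The feasible set `Y_s(x)` for the global switching sequence `s`. -/
def feasibleSw (s : ∀ i, D.SwSeq i) (x : S.State) : Set D.Var :=
  {y | (∀ i, y i ∈ D.localSet i (x i) ∩ D.switchSet i (s i)) ∧ D.Consistent y}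

/-- The set `X_0` of states for which the MPC problem is feasible. -/
def X0 : Set S.State := {x | (D.feasible x).Nonempty}

/-- The global terminal set. -/
def XTglobal : Set S.State := {x | ∀ i, x i ∈ D.XT i}

/-! ### Roll-out, generated switching sequences, weak feasibility -/

/-- Predicted states under the true dynamics and the input sequences `u`
(the zero input after the horizon is never used). -/
def roll (x : S.State) (u : ∀ i, D.InpSeq i) : ℕ → S.State
  | 0 => x
  | k + 1 => S.next (roll x u k) (fun i => if hk : k < D.N then u i ⟨k, hk⟩ else 0)

/-- Distributed roll-out of the dynamics from `x` under `u`. -/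
def rollout (x : S.State) (u : ∀ i, D.InpSeq i) : D.Var :=
  fun i => ((fun k => D.roll x u k i, fun j k => D.roll x u k j), u i)

/-- The switching sequences generated by the initial state, inputs and copies in `y`: roll out the
local dynamics, branching over all regions whose closure contains the current state. -/
def evalSwitching (i : Fin M) (xi : S.St i) (y : D.LocVar i) : Set (D.SwSeq i) :=
  {s | ∃ ξ : D.Traj i, ξ 0 = xi ∧ (∀ k, ξ k ∈ closure (S.P i (s k))) ∧
    ∀ k : Fin D.N, ξ k.succ =
      S.aff i (s k.castSucc) (ξ k.castSucc) (LocVar.inp y k)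
        (fun j => LocVar.copy y j k.castSucc)}

/-- The input sequences `u` are weakly feasible at `x`: they generate a global switching sequence,
and every one that they generate has a nonempty feasible set. -/
def WeaklyFeasible (x : S.State) (u : ∀ i, D.InpSeq i) : Prop :=
  (∃ s : ∀ i, D.SwSeq i, ∀ i, s i ∈ D.evalSwitching i (x i) (D.rollout x u i)) ∧
  ∀ s : ∀ i, D.SwSeq i, (∀ i, s i ∈ D.evalSwitching i (x i) (D.rollout x u i)) →
    (D.feasibleSw s x).Nonempty

/-! ### Switching ADMM -/

/-- Euclidean inner product of augmented trajectories. -/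
def augDot {i : Fin M} (a b : D.Aug i) : ℝ :=
  ∑ k, a.1 k ⬝ᵥ b.1 k + ∑ j, ∑ k, a.2 j k ⬝ᵥ b.2 j k

/-- The components of the consensus variable `z` that are relevant to subsystem `i`. -/
def augOf (z : ∀ i, D.Traj i) (i : Fin M) : D.Aug i := (z i, fun j => z j)

/-- Objective of the local minimization. -/
def localObj (i : Fin M) (lam : D.Aug i) (z : ∀ i, D.Traj i) (y : D.LocVar i) : ℝ :=
  D.cost i y + D.augDot lam y.1 + D.ρ / 2 * D.augDot (y.1 - D.augOf z i) (y.1 - D.augOf z i)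

/-- Average of the trajectory of `i` and of all copies of it held by other subsystems. -/
def average (y : D.Var) (i : Fin M) : D.Traj i :=
  ((Fintype.card {j // i ∈ S.nbr j} : ℝ) + 1)⁻¹ •
    (LocVar.own (y i) + ∑ j : {j // i ∈ S.nbr j}, LocVar.copy (y j) ⟨i, j.2⟩)

/-- A (never-ending) execution of the switching ADMM procedure at state `x` with initial guess `u`.
Here `s τ`, `z τ`, `lam τ` are the iterates at the beginning of iteration `τ`, and `y τ` is the
solution of the local minimizations in iteration `τ`. -/
structure IsSwADMM (x : S.State) (u : ∀ i, D.InpSeq i) (s : ℕ → ∀ i, D.SwSeq i) (y : ℕ → D.Var)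
    (z : ℕ → ∀ i, D.Traj i) (lam : ℕ → ∀ i, D.Aug i) : Prop where
  z_zero : z 0 = 0
  lam_zero : lam 0 = 0
  s_zero : ∀ i, s 0 i ∈ D.evalSwitching i (x i) (D.rollout x u i)
  y_mem : ∀ τ i, y τ i ∈ D.localSet i (x i) ∩ D.switchSet i (s τ i)
  y_min : ∀ τ i, IsMinOn (D.localObj i (lam τ i) (z τ))
    (D.localSet i (x i) ∩ D.switchSet i (s τ i)) (y τ i)
  z_succ : ∀ τ i, z (τ + 1) i = D.average (y τ) i
  lam_succ : ∀ τ i, lam (τ + 1) i = lam τ i + D.ρ • ((y τ i).1 - D.augOf (z (τ + 1)) i)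
  s_switch : ∀ τ < D.Tcut, ∀ i, (D.evalSwitching i (x i) (y τ i) \ {s τ i}).Nonempty →
    s (τ + 1) i ∈ D.evalSwitching i (x i) (y τ i) \ {s τ i}
  s_keep : ∀ τ < D.Tcut, ∀ i, ¬ (D.evalSwitching i (x i) (y τ i) \ {s τ i}).Nonempty →
    s (τ + 1) i = s τ i
  s_frozen : ∀ τ, D.Tcut ≤ τ → s (τ + 1) = s τ

/-- `y'` is an output of switching ADMM as the number of iterations tends to infinity. -/
def IsSwADMMOutput (x : S.State) (u : ∀ i, D.InpSeq i) (y' : D.Var) : Prop :=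
  ∃ s y z lam, D.IsSwADMM x u s y z lam ∧ Tendsto y atTop (𝓝 y')

/-! ### The stabilizing distributed MPC algorithm -/

open Classical in
/-- `y` is a plan computed at `x` from the initial guess `u`: the output of switching ADMM, unless
the roll-out of the guess is feasible (has finite value) and the local cost of the output exceeds
that of the roll-out for some subsystem; in that case the roll-out is kept. -/
def IsPlan (x : S.State) (u : ∀ i, D.InpSeq i) (y : D.Var) : Prop :=
  ∃ y', D.IsSwADMMOutput x u y' ∧
    y = if D.rollout x u ∈ D.feasible x ∧ ¬ ∀ i, D.cost i (y' i) ≤ D.cost i (D.rollout x u i)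
      then D.rollout x u else y'

/-- The guess obtained by shifting the inputs of the previous plan and appending the terminal
controller. -/
def IsShiftedGuess (ybar : D.Var) (u : ∀ i, D.InpSeq i) : Prop :=
  ∀ i, ∃ l, LocVar.own (ybar i) (Fin.last D.N) ∈ S.P i l ∧
    u i = fun k : Fin D.N => if hk : (k : ℕ) + 1 < D.N then LocVar.inp (ybar i) ⟨k + 1, hk⟩
      else D.K i l *ᵥ LocVar.own (ybar i) (Fin.last D.N)

/-- The initial guess available to the controller: the given guess `u0` at the first time step
(no previous plan), the shifted previous plan afterwards. -/
def IsGuess (u0 : ∀ i, D.InpSeq i) (mem : Option D.Var) (u : ∀ i, D.InpSeq i) : Prop :=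
  match mem with
  | none => u = u0
  | some ybar => D.IsShiftedGuess ybar u

/-- State of the closed loop: network state and stored previous plan. -/
abbrev LoopState : Type := S.State × Option D.Var

/-- One time step of the closed loop. The first alternative is the terminal mode, the second the
MPC mode. -/
def Step (u0 : ∀ i, D.InpSeq i) (σ σ' : D.LoopState) : Prop :=
  (σ.1 ∈ D.XTglobal ∧ σ'.2 = σ.2 ∧ ∃ l : ∀ i, Fin (S.L i), (∀ i, σ.1 i ∈ S.P i (l i)) ∧
    σ'.1 = S.next σ.1 (fun i => D.K i (l i) *ᵥ σ.1 i)) ∨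
  (σ.1 ∉ D.XTglobal ∧ ∃ u y, D.IsGuess u0 σ.2 u ∧ D.IsPlan σ.1 u y ∧ σ'.2 = some y ∧
    σ'.1 = S.next σ.1 (fun i => LocVar.inp (y i) ⟨0, D.N_pos⟩))

/-- `σ` is a closed-loop trajectory from the initial state `x0` with first guess `u0`. -/
def IsClosedLoop (x0 : S.State) (u0 : ∀ i, D.InpSeq i) (σ : ℕ → D.LoopState) : Prop :=
  σ 0 = (x0, none) ∧ ∀ t, D.Step u0 (σ t) (σ (t + 1))

/-- Admissible initial data: a feasible initial state with, unless it lies in the terminal set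
already, a weakly feasible first guess. -/
def IsInitial (x0 : S.State) (u0 : ∀ i, D.InpSeq i) : Prop :=
  x0 ∈ D.X0 ∧ (x0 ∉ D.XTglobal → D.WeaklyFeasible x0 u0)

/-! ### Assumptions -/

/-- Coupling: at states in `X_0`, if all local problems for `s` are feasible, so is the global
problem for `s`. -/
def CouplingAssumption : Prop :=
  ∀ x ∈ D.X0, ¬ ∃ s : ∀ i, D.SwSeq i, D.feasibleSw s x = ∅ ∧
    ∀ i, (D.localSet i (x i) ∩ D.switchSet i (s i)).Nonempty

/-- Controllable pieces with stabilizing gains, and an equilibrium at the origin. -/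
structure SystemAssumption : Prop where
  controllable : ∀ i l, IsControllablePair (S.A i l) (S.B i l)
  schur : ∀ i l, IsSchur (S.A i l + S.B i l * D.K i l)
  equilibrium : ∀ i l, 0 ∈ closure (S.P i l) → S.c i l = 0

/-- Terminal sets: closed neighbourhoods of the origin relative to the state constraint sets, inside
the regions touching the origin, invariant under the terminal controllers for all states of the
neighbours in their terminal sets; the terminal controllers also preserve the coupled constraints. -/
structure TerminalAssumption : Prop where
  isClosed : ∀ i, IsClosed (D.XT i)
  zero_mem : ∀ i, 0 ∈ D.XT i
  mem_nhdsWithin : ∀ i, D.XT i ∈ 𝓝[S.X i] 0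
  subset : ∀ i, D.XT i ⊆ ⋃ l ∈ {l | 0 ∈ closure (S.P i l)}, S.P i l
  input_mem : ∀ i, ∀ x ∈ D.XT i, ∀ l, x ∈ S.P i l → D.K i l *ᵥ x ∈ S.U i
  invariant : ∀ i, ∀ x ∈ D.XT i, ∀ l, x ∈ S.P i l →
    ∀ xn : ∀ j : S.nbr i, S.St j, (∀ j : S.nbr i, xn j ∈ D.XT j) →
      S.f i x (D.K i l *ᵥ x) xn ∈ D.XT i
  coupled : ∀ x ∈ D.XTglobal, (∀ i, S.h i (x i) (S.nbrState x i) ≤ 0) →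
    ∀ l : ∀ i, Fin (S.L i), (∀ i, x i ∈ S.P i (l i)) →
      ∀ i, S.h i (S.next x (fun i => D.K i (l i) *ᵥ x i) i)
        (S.nbrState (S.next x (fun i => D.K i (l i) *ᵥ x i)) i) ≤ 0

/-- Quadratic costs, and a terminal cost that is a common Lyapunov function on the terminal set. -/
structure CostAssumption : Prop where
  posDef_Q : ∀ i, (D.Q i).PosDef
  posDef_R : ∀ i, (D.R i).PosDef
  posDef_Φ : ∀ i, (D.Φ i).PosDef
  posSemidef_Qc : ∀ i j, (D.Qc i j).PosSemidef
  decrease : ∀ x ∈ D.XTglobal, ∀ l : ∀ i, Fin (S.L i), (∀ i, x i ∈ S.P i (l i)) →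
    ∑ i, (D.Vf i (S.f i (x i) (D.K i (l i) *ᵥ x i) (S.nbrState x i)) - D.Vf i (x i)
      + D.stage i (x i) (D.K i (l i) *ᵥ x i) (S.nbrState x i)) ≤ 0

/-! ### Conclusions -/

/-- The origin is exponentially stable for the closed loop, with region of attraction `X_0`:
uniform exponential decay from initial states near the origin, exponential convergence with the
same rate from every initial state in `X_0`, with a constant that is uniform on the whole of `X_0`
if the constraint sets are bounded. (The norm is the sup norm, equivalent to the Euclidean one.) -/
def ExponentiallyStabilizing : Prop :=
  ∃ γ : ℝ, 0 < γ ∧ γ < 1 ∧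
    (∃ δ > 0, ∃ C : ℝ, ∀ x0 u0 σ, D.IsInitial x0 u0 → D.IsClosedLoop x0 u0 σ → ‖x0‖ < δ →
      ∀ t, ‖(σ t).1‖ ≤ C * γ ^ t * ‖x0‖) ∧
    (∀ x0 u0 σ, D.IsInitial x0 u0 → D.IsClosedLoop x0 u0 σ →
      ∃ C : ℝ, ∀ t, ‖(σ t).1‖ ≤ C * γ ^ t * ‖x0‖) ∧
    ((∀ i, Bornology.IsBounded (S.X i)) → (∀ i, Bornology.IsBounded (S.U i)) →
      ∃ C : ℝ, ∀ x0 u0 σ, D.IsInitial x0 u0 → D.IsClosedLoop x0 u0 σ →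
        ∀ t, ‖(σ t).1‖ ≤ C * γ ^ t * ‖x0‖)

/-- The control law is well defined along the closed loop: from every loop state that is reached,
a next time step exists, and every execution of switching ADMM that the algorithm can start there
converges. -/
def WellPosed : Prop :=
  ∀ x0 u0, D.IsInitial x0 u0 → ∀ σ, Relation.ReflTransGen (D.Step u0) (x0, none) σ →
    (∃ σ', D.Step u0 σ σ') ∧
    (σ.1 ∉ D.XTglobal → ∀ u, D.IsGuess u0 σ.2 u → ∀ s y z lam, D.IsSwADMM σ.1 u s y z lam →
      ∃ y', Tendsto y atTop (𝓝 y'))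

end MPCDesign

end

/-!
Once its switching sequences are frozen, switching ADMM is ADMM for a convex quadratic consensus
problem, to which Assumption 1 supplies a feasible point. Along a convergent run a nonzero limit of
the residuals would make the multipliers grow linearly, and minimality against a feasible competitor
forbids this; so the limit is consistent, that is, feasible. If the constraints are polyhedral,
Farkas' lemma gives a saddle point, and the usual Lyapunov function of ADMM forces convergence.

Hence every plan is the roll-out of its inputs. Shifting a plan and appending the terminal feedback
gives a guess with a feasible roll-out, and since the controller falls back on that roll-out, the
cost of the plan drops by at least the stage cost at every step. Outside the terminal set the stage
cost is bounded away from zero, so the terminal set is reached after a time controlled by the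
initial cost; inside it the terminal cost is a quadratic Lyapunov function.
-/

/-! ### Polyhedral sets and Lagrange multipliers -/

section Polyhedral

variable {V W : Type*} [AddCommGroup V] [Module ℝ V] [AddCommGroup W] [Module ℝ W]

/-- A polyhedral subset of a real vector space: the solution set of finitely many affine
inequalities. Unlike `IsPolyhedron` it does not refer to coordinates, so that it applies to sets of
trajectories. -/
def IsPolyhedral (C : Set V) : Prop :=
  ∃ s : Finset (V →ᵃ[ℝ] ℝ), C = {y | ∀ k ∈ s, 0 ≤ k y}

namespace IsPolyhedral

theorem inter {C C' : Set V} (h : IsPolyhedral C) (h' : IsPolyhedral C') :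
    IsPolyhedral (C ∩ C') := by
  classical
  obtain ⟨s, rfl⟩ := h
  obtain ⟨s', rfl⟩ := h'
  refine ⟨s ∪ s', ?_⟩
  ext y
  simp only [Set.mem_inter_iff, Set.mem_ofPred_eq, Finset.mem_union, or_imp, forall_and]

theorem setOf_forall_mem {ι : Type*} [Finite ι] {C : ι → Set V} (h : ∀ i, IsPolyhedral (C i)) :
    IsPolyhedral {y | ∀ i, y ∈ C i} := by
  classical
  cases nonempty_fintype ι
  choose s hs using h
  refine ⟨Finset.univ.biUnion s, ?_⟩
  ext y
  simp only [hs, Set.mem_ofPred_eq, Finset.mem_biUnion, Finset.mem_univ, true_and]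
  exact ⟨fun hy k ⟨i, hk⟩ => hy i k hk, fun hy i k hk => hy k ⟨i, hk⟩⟩

theorem preimage {C : Set W} (h : IsPolyhedral C) (g : V →ᵃ[ℝ] W) : IsPolyhedral (g ⁻¹' C) := by
  classical
  obtain ⟨s, rfl⟩ := h
  refine ⟨s.image fun k => k.comp g, ?_⟩
  ext y
  simp

theorem halfSpace (k : V →ᵃ[ℝ] ℝ) : IsPolyhedral {y | 0 ≤ k y} :=
  ⟨{k}, by simp⟩

theorem pi_Ici_zero {ι : Type*} [Finite ι] : IsPolyhedral (Set.Ici (0 : ι → ℝ)) :=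
  setOf_forall_mem fun i => halfSpace (LinearMap.proj i : (ι → ℝ) →ₗ[ℝ] ℝ).toAffineMap

theorem setOf_le {ι : Type*} [Finite ι] (g g' : V →ᵃ[ℝ] ι → ℝ) :
    IsPolyhedral {y | g y ≤ g' y} := by
  convert pi_Ici_zero.preimage (g' - g) using 1
  ext y
  simp

theorem setOf_eq {ι : Type*} [Finite ι] (g g' : V →ᵃ[ℝ] ι → ℝ) :
    IsPolyhedral {y | g y = g' y} := by
  convert (setOf_le g g').inter (setOf_le g' g) using 1
  ext y
  exact le_antisymm_iff

theorem convex {C : Set V} (h : IsPolyhedral C) : Convex ℝ C := by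
  obtain ⟨s, rfl⟩ := h
  have hC : {y : V | ∀ k ∈ s, 0 ≤ k y} = ⋂ k ∈ s, k ⁻¹' Set.Ici 0 := by ext; simp
  rw [hC]
  exact convex_iInter₂ fun k _ => (convex_Ici (0 : ℝ)).affine_preimage k

end IsPolyhedral

theorem IsPolyhedron.isPolyhedral {n : ℕ} {T : Set (Fin n → ℝ)} (h : IsPolyhedron T) :
    IsPolyhedral T := by
  obtain ⟨q, G, g, rfl⟩ := h
  exact .setOf_le (Matrix.mulVecLin G).toAffineMap (AffineMap.const ℝ (Fin n → ℝ) g)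

theorem mem_hull_image_insert {ι : Type*} {s : Set ι} {q : ι} {a : ι → Module.Dual ℝ V}
    {b : Module.Dual ℝ V} {v : V} (ha : ∀ k ∈ s, 0 ≤ a k v) (hbv : b v ≤ 0)
    (hb : b + b v • a q ∈ PointedCone.hull ℝ ((fun k => a k + a k v • a q) '' s)) :
    b ∈ PointedCone.hull ℝ (a '' insert q s) := by
  have hcone : ∀ {t : ℝ} {k : ι}, 0 ≤ t → k ∈ insert q s →
      t • a k ∈ PointedCone.hull ℝ (a '' insert q s) := fun ht hk =>
    PointedCone.smul_mem _ ht (PointedCone.subset_hull (Set.mem_image_of_mem a hk))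
  have hle : PointedCone.hull ℝ ((fun k => a k + a k v • a q) '' s) ≤
      PointedCone.hull ℝ (a '' insert q s) := by
    rw [Submodule.span_le]
    rintro _ ⟨k, hk, rfl⟩
    have hk' := hcone zero_le_one (Set.mem_insert_of_mem q hk)
    rw [one_smul] at hk'
    exact add_mem hk' (hcone (ha k hk) (Set.mem_insert q s))
  have hsum := add_mem (hle hb) (hcone (neg_nonneg.2 hbv) (Set.mem_insert q s))
  convert hsum using 1
  module

theorem mem_hull_of_forall_nonneg {ι : Type*} (s : Finset ι) (a : ι → Module.Dual ℝ V)
    (b : Module.Dual ℝ V) (h : ∀ v, (∀ k ∈ s, 0 ≤ a k v) → 0 ≤ b v) :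
    b ∈ PointedCone.hull ℝ (a '' s) := by
  classical
  induction s using Finset.induction_on generalizing a b with
  | empty =>
    have hb : b = 0 := by
      ext v
      have hneg := h (-v) (by simp)
      rw [map_neg] at hneg
      exact le_antisymm (neg_nonneg.1 hneg) (h v (by simp))
    exact hb ▸ zero_mem _
  | insert q s _ ih =>
    by_cases hs : ∀ v, (∀ k ∈ s, 0 ≤ a k v) → 0 ≤ b v
    · exact Submodule.span_mono (Set.image_mono (by simp)) (ih a b hs)
    push Not at hs
    obtain ⟨w, hw, hbw⟩ := hs
    have hqw : a q w < 0 := by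
      by_contra! hqw
      exact absurd (h w (Finset.forall_mem_insert .. |>.2 ⟨hqw, hw⟩)) hbw.not_ge
    have ht : 0 < -(a q w)⁻¹ := neg_pos.2 (inv_lt_zero.2 hqw)
    obtain ⟨v₀, hv₀, hbv₀, hqv₀⟩ : ∃ v₀, (∀ k ∈ s, 0 ≤ a k v₀) ∧ b v₀ ≤ 0 ∧ a q v₀ = -1 := by
      refine ⟨-(a q w)⁻¹ • w, fun k hk => ?_, ?_, ?_⟩ <;> rw [map_smul, smul_eq_mul]
      · exact mul_nonneg ht.le (hw k hk)
      · exact (mul_neg_of_pos_of_neg ht hbw).le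
      · rw [neg_mul, inv_mul_cancel₀ hqw.ne]
    -- Projecting along `v₀` onto the kernel of `a q` removes the functional `a q`.
    have hproj : b + b v₀ • a q ∈ PointedCone.hull ℝ ((fun k => a k + a k v₀ • a q) '' s) := by
      refine ih _ _ fun v hv => ?_
      have hb := h (v + a q v • v₀) (Finset.forall_mem_insert .. |>.2
        ⟨by simp [hqv₀], fun k hk => by simpa [mul_comm] using hv k hk⟩)
      simpa [mul_comm] using hb
    rw [Finset.coe_insert]
    exact mem_hull_image_insert (fun k hk => hv₀ k hk) hbv₀ hproj

theorem nonneg_of_mem_hull {A : Set (Module.Dual ℝ V)} {v : V} (hA : ∀ a ∈ A, 0 ≤ a v)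
    {c : Module.Dual ℝ V} (hc : c ∈ PointedCone.hull ℝ A) : 0 ≤ c v := by
  induction hc using Submodule.span_induction with
  | mem a ha => exact hA a ha
  | zero => exact le_rfl
  | add a b _ _ ha hb => exact add_nonneg ha hb
  | smul t a _ ha => exact mul_nonneg t.2 ha

theorem affineMap_apply_eq_add_linear (k : V →ᵃ[ℝ] ℝ) (y₀ y : V) :
    k y = k y₀ + k.linear (y - y₀) := by
  rw [← vsub_eq_sub, AffineMap.linearMap_vsub, vsub_eq_sub, add_sub_cancel]

theorem exists_pos_forall_nonneg_add_smul {s : Finset (V →ᵃ[ℝ] ℝ)} {y₀ v : V}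
    (hy₀ : ∀ k ∈ s, 0 ≤ k y₀) (hv : ∀ k ∈ s, k y₀ = 0 → 0 ≤ k.linear v) :
    ∃ t : ℝ, 0 < t ∧ ∀ k ∈ s, 0 ≤ k (y₀ + t • v) := by
  suffices hev : ∀ᶠ t in 𝓝[>] (0 : ℝ), ∀ k ∈ s, 0 ≤ k (y₀ + t • v) from
    (eventually_mem_nhdsWithin.and hev).exists
  rw [Filter.eventually_all_finset]
  intro k hk
  simp only [affineMap_apply_eq_add_linear k y₀ (y₀ + _), add_sub_cancel_left, map_smul,
    smul_eq_mul]
  rcases (hy₀ k hk).eq_or_lt with hactive | hinactive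
  · filter_upwards [self_mem_nhdsWithin] with t ht
    rw [← hactive, zero_add]
    exact mul_nonneg (le_of_lt ht) (hv k hk hactive.symm)
  · have hlim : Tendsto (fun t : ℝ => k y₀ + t * k.linear v) (𝓝 0) (𝓝 (k y₀)) := by
      simpa using (by fun_prop : Continuous fun t : ℝ => k y₀ + t * k.linear v).tendsto 0
    exact ((hlim.eventually_const_lt hinactive).filter_mono nhdsWithin_le_nhds).mono
      fun _ ht => ht.le

theorem IsPolyhedral.exists_multiplier {C : Set V} (hC : IsPolyhedral C) (L : Submodule ℝ V)
    (b : Module.Dual ℝ V) {y₀ : V} (hy₀ : y₀ ∈ C)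
    (hmin : ∀ y ∈ C, y - y₀ ∈ L → 0 ≤ b (y - y₀)) :
    ∃ ν ∈ L.dualAnnihilator, ∀ y ∈ C, 0 ≤ b (y - y₀) + ν (y - y₀) := by
  classical
  obtain ⟨s, rfl⟩ := hC
  have hfarkas : L.dualRestrict b ∈ PointedCone.hull ℝ
      ((fun k : V →ᵃ[ℝ] ℝ => L.dualRestrict k.linear) '' (s.filter fun k => k y₀ = 0)) := by
    refine mem_hull_of_forall_nonneg _ _ _ fun v hv => ?_
    obtain ⟨t, ht, hmem⟩ := exists_pos_forall_nonneg_add_smul hy₀ (v := (v : V)) fun k hk hk₀ =>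
      hv k (Finset.mem_filter.2 ⟨hk, hk₀⟩)
    have hstep := hmin _ hmem (by simpa using L.smul_mem t v.2)
    rw [add_sub_cancel_left, map_smul] at hstep
    exact nonneg_of_mul_nonneg_right hstep ht
  obtain ⟨c, hc, hcb⟩ : ∃ c ∈ PointedCone.hull ℝ
      (AffineMap.linear '' ((s.filter fun k => k y₀ = 0 : Finset (V →ᵃ[ℝ] ℝ)) : Set (V →ᵃ[ℝ] ℝ))),
      L.dualRestrict c = L.dualRestrict b := by
    rw [← PointedCone.mem_map]
    change _ ∈ Submodule.map _ _
    rwa [Submodule.map_span, Set.image_image]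
  refine ⟨c - b, ?_, fun y hy => ?_⟩
  · rw [← L.dualRestrict_ker_eq_dualAnnihilator, LinearMap.mem_ker, map_sub, hcb, sub_self]
  · rw [LinearMap.sub_apply, add_sub_cancel]
    refine nonneg_of_mem_hull ?_ hc
    rintro _ ⟨k, hk, rfl⟩
    obtain ⟨hk, hk₀⟩ := Finset.mem_filter.1 hk
    simpa only [affineMap_apply_eq_add_linear k y₀ y, hk₀, zero_add] using hy k hk

end Polyhedral

theorem IsPolyhedral.isClosed {V : Type*} [NormedAddCommGroup V] [NormedSpace ℝ V]
    [FiniteDimensional ℝ V] {C : Set V} (hC : IsPolyhedral C) : IsClosed C := by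
  obtain ⟨s, rfl⟩ := hC
  simp only [Set.ofPred_forall]
  exact isClosed_biInter fun k _ =>
    isClosed_le continuous_const k.continuous_of_finiteDimensional

/-! ### The alternating direction method of multipliers -/

theorem nonneg_of_forall_add_mul_nonneg {p q : ℝ} (h : ∀ t : ℝ, 0 < t → t ≤ 1 → 0 ≤ p + t * q) :
    0 ≤ p := by
  have hlim : Tendsto (fun t : ℝ => p + t * q) (𝓝[>] 0) (𝓝 p) := by
    simpa using ((by fun_prop : Continuous fun t : ℝ => p + t * q).tendsto 0).mono_left
      nhdsWithin_le_nhds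
  refine ge_of_tendsto hlim ?_
  filter_upwards [Ioc_mem_nhdsGT (zero_lt_one' ℝ)] with t ht using h t ht.1 ht.2

theorem continuous_bilinForm {E : Type*} [NormedAddCommGroup E] [NormedSpace ℝ E]
    [FiniteDimensional ℝ E] (B : LinearMap.BilinForm ℝ E) : Continuous fun p : E × E => B p.1 p.2 :=
  (by fun_prop : Continuous fun p : E × E => B.toContinuousBilinearMap p.1 p.2)

theorem tendsto_bilinForm_apply {E ι : Type*} [NormedAddCommGroup E] [NormedSpace ℝ E]
    [FiniteDimensional ℝ E] (B : LinearMap.BilinForm ℝ E) {l : Filter ι} {u v : ι → E} {a b : E}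
    (hu : Tendsto u l (𝓝 a)) (hv : Tendsto v l (𝓝 b)) :
    Tendsto (fun i => B (u i) (v i)) l (𝓝 (B a b)) :=
  ((continuous_bilinForm B).tendsto (a, b)).comp (hu.prodMk_nhds hv)

/-- A quadratic consensus problem: minimize `B y y` over the `y ∈ C` with `T y ∈ L`. The form `G` is
the inner product in which the augmented Lagrangian, with penalty parameter `ρ`, measures the
distance of `T y` to the consensus subspace `L`. -/
structure ConsensusProblem (V H : Type*) [AddCommGroup V] [Module ℝ V] [AddCommGroup H]
    [Module ℝ H] where
  B : LinearMap.BilinForm ℝ V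
  isPosSemidef_B : B.IsPosSemidef
  G : LinearMap.BilinForm ℝ H
  isSymm_G : G.IsSymm
  pos_G : ∀ w, w ≠ 0 → 0 < G w w
  T : V →ₗ[ℝ] H
  C : Set V
  L : Submodule ℝ H
  ρ : ℝ
  ρ_pos : 0 < ρ

namespace ConsensusProblem

section Algebraic

variable {V H : Type*} [AddCommGroup V] [Module ℝ V] [AddCommGroup H] [Module ℝ H]
  (P : ConsensusProblem V H)

/-- The augmented Lagrangian of `P` with multiplier `lam` and consensus variable `z`, up to terms
that do not depend on `y`. -/
noncomputable def augLagrangian (lam z : H) (y : V) : ℝ :=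
  P.B y y + P.G lam (P.T y) + P.ρ / 2 * P.G (P.T y - z) (P.T y - z)

/-- A saddle point of the Lagrangian of `P`, expressed by its first order conditions: a feasible
point `y₀` and a multiplier `lam₀`, orthogonal to `L`, for which `y₀` is stationary. -/
structure IsSaddlePoint (y₀ : V) (lam₀ : H) : Prop where
  mem : y₀ ∈ P.C
  map_mem : P.T y₀ ∈ P.L
  orthogonal : ∀ w ∈ P.L, P.G lam₀ w = 0
  stationary : ∀ y ∈ P.C, 0 ≤ 2 * P.B y₀ (y - y₀) + P.G lam₀ (P.T (y - y₀))

/-- A run of the alternating direction method of multipliers for `P`. That `z (τ + 1)` is the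
`G`-orthogonal projection of `T (y τ)` onto `L` is encoded in `z_mem`, `lam_orthogonal` and
`lam_succ`. -/
structure IsADMM (y : ℕ → V) (z lam : ℕ → H) : Prop where
  y_mem : ∀ τ, y τ ∈ P.C
  y_min : ∀ τ, IsMinOn (P.augLagrangian (lam τ) (z τ)) P.C (y τ)
  z_mem : ∀ τ, z τ ∈ P.L
  lam_orthogonal : ∀ τ, ∀ w ∈ P.L, P.G (lam τ) w = 0
  lam_succ : ∀ τ, lam (τ + 1) = lam τ + P.ρ • (P.T (y τ) - z (τ + 1))

variable {P}

theorem nonneg_G (w : H) : 0 ≤ P.G w w := by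
  rcases eq_or_ne w 0 with rfl | hw
  · simp
  · exact (P.pos_G w hw).le

theorem nondegenerate_G : P.G.Nondegenerate :=
  ⟨fun w hw => by_contra fun h => (P.pos_G w h).ne' (hw w),
    fun w hw => by_contra fun h => (P.pos_G w h).ne' (hw w)⟩

theorem IsADMM.residual_orthogonal {y : ℕ → V} {z lam : ℕ → H} (h : P.IsADMM y z lam) (τ : ℕ)
    {w : H} (hw : w ∈ P.L) : P.G (P.T (y τ) - z (τ + 1)) w = 0 := by
  have hlam := h.lam_orthogonal (τ + 1) w hw
  rw [h.lam_succ, map_add, LinearMap.add_apply, h.lam_orthogonal τ w hw, map_smul,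
    LinearMap.smul_apply, smul_eq_mul, zero_add] at hlam
  exact (mul_eq_zero.1 hlam).resolve_left P.ρ_pos.ne'

theorem IsADMM.lam_eq_add_sum {y : ℕ → V} {z lam : ℕ → H} (h : P.IsADMM y z lam) (τ : ℕ) :
    lam τ = lam 0 + P.ρ • ∑ k ∈ Finset.range τ, (P.T (y k) - z (k + 1)) := by
  induction τ with
  | zero => simp
  | succ τ ih => rw [h.lam_succ, Finset.sum_range_succ, smul_add, ← add_assoc, ← ih]

theorem variational_inequality {lam z : H} {y₀ y : V} (hC : Convex ℝ P.C) (hy₀ : y₀ ∈ P.C)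
    (hmin : IsMinOn (P.augLagrangian lam z) P.C y₀) (hy : y ∈ P.C) :
    0 ≤ 2 * P.B y₀ (y - y₀) + P.G (lam + P.ρ • (P.T y₀ - z)) (P.T (y - y₀)) := by
  refine nonneg_of_forall_add_mul_nonneg
    (q := P.B (y - y₀) (y - y₀) + P.ρ / 2 * P.G (P.T (y - y₀)) (P.T (y - y₀)))
    fun t ht0 ht1 => nonneg_of_mul_nonneg_right ?_ ht0
  have hle : P.augLagrangian lam z y₀ ≤ P.augLagrangian lam z (y₀ + t • (y - y₀)) :=
    hmin (hC.add_smul_sub_mem hy₀ hy ⟨ht0.le, ht1⟩)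
  have hT : P.T (y₀ + t • (y - y₀)) - z = (P.T y₀ - z) + t • P.T (y - y₀) := by
    rw [map_add, map_smul]; abel
  rw [augLagrangian, augLagrangian, hT] at hle
  generalize P.T y₀ - z = r at hle ⊢
  generalize y - y₀ = d at hle ⊢
  simp only [map_add, map_smul, LinearMap.add_apply, LinearMap.smul_apply, smul_eq_mul] at hle ⊢
  rw [P.isPosSemidef_B.isSymm.eq d y₀, P.isSymm_G.eq (P.T d) r] at hle
  linarith

/-- The Lyapunov function of the method of multipliers with respect to a saddle point. -/
noncomputable def lyapunov (P : ConsensusProblem V H) (y₀ : V) (lam₀ lam z : H) : ℝ :=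
  P.ρ⁻¹ * P.G (lam - lam₀) (lam - lam₀) + P.ρ * P.G (z - P.T y₀) (z - P.T y₀)

theorem lyapunov_nonneg (y₀ : V) (lam₀ lam z : H) : 0 ≤ P.lyapunov y₀ lam₀ lam z :=
  add_nonneg (mul_nonneg (inv_nonneg.2 P.ρ_pos.le) (nonneg_G _))
    (mul_nonneg P.ρ_pos.le (nonneg_G _))

section Convergence

variable {y : ℕ → V} {z lam : ℕ → H} {y₀ : V} {lam₀ : H}

/-- The optimality of `y τ` tested against `y₀`, added to the stationarity of `y₀` tested
against `y τ`. -/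
theorem IsADMM.monotonicity (h : P.IsADMM y z lam) (hC : Convex ℝ P.C)
    (h₀ : P.IsSaddlePoint y₀ lam₀) (τ : ℕ) :
    2 * P.B (y τ - y₀) (y τ - y₀) + P.G (lam τ - lam₀) (P.T (y τ) - z (τ + 1))
      + P.ρ * P.G (P.T (y τ) - z (τ + 1)) (P.T (y τ) - z (τ + 1))
      + P.ρ * P.G (z (τ + 1) - z τ) (z (τ + 1) - P.T y₀) ≤ 0 := by
  have hopt := variational_inequality hC (h.y_mem τ) (h.y_min τ) h₀.mem
  have hstat := h₀.stationary (y τ) (h.y_mem τ)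
  have hp : z (τ + 1) - P.T y₀ ∈ P.L := P.L.sub_mem (h.z_mem (τ + 1)) h₀.map_mem
  have hrp := h.residual_orthogonal τ hp
  have hdr := h.residual_orthogonal τ (P.L.sub_mem (h.z_mem (τ + 1)) (h.z_mem τ))
  rw [← P.isSymm_G.eq] at hdr
  have hlamp := h.lam_orthogonal τ _ hp
  have hlam₀p := h₀.orthogonal _ hp
  have hB : P.B (y τ) (y₀ - y τ) = -(P.B y₀ (y τ - y₀) + P.B (y τ - y₀) (y τ - y₀)) := by
    simp only [map_sub, LinearMap.sub_apply]
    ring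
  have hT : P.T (y₀ - y τ) = -((P.T (y τ) - z (τ + 1)) + (z (τ + 1) - P.T y₀)) := by
    rw [map_sub]; abel
  have hT' : P.T (y τ - y₀) = (P.T (y τ) - z (τ + 1)) + (z (τ + 1) - P.T y₀) := by
    rw [map_sub]; abel
  have hr : P.T (y τ) - z τ = (P.T (y τ) - z (τ + 1)) + (z (τ + 1) - z τ) := by abel
  rw [hB, hT, hr] at hopt
  rw [hT'] at hstat
  generalize P.T (y τ) - z (τ + 1) = r at *
  generalize z (τ + 1) - P.T y₀ = p at *
  generalize z (τ + 1) - z τ = d at *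
  simp only [map_add, map_neg, map_sub, map_smul, LinearMap.add_apply, LinearMap.smul_apply,
    LinearMap.sub_apply, smul_eq_mul, hrp, hdr, hlamp, hlam₀p] at hopt hstat ⊢
  linarith

theorem IsADMM.lyapunov_descent (h : P.IsADMM y z lam) (hC : Convex ℝ P.C)
    (h₀ : P.IsSaddlePoint y₀ lam₀) (τ : ℕ) :
    4 * P.B (y τ - y₀) (y τ - y₀)
      + P.ρ * P.G (P.T (y τ) - z (τ + 1)) (P.T (y τ) - z (τ + 1))
      ≤ P.lyapunov y₀ lam₀ (lam τ) (z τ) - P.lyapunov y₀ lam₀ (lam (τ + 1)) (z (τ + 1)) := by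
  have hmono := h.monotonicity hC h₀ τ
  have hlam : lam (τ + 1) - lam₀ = (lam τ - lam₀) + P.ρ • (P.T (y τ) - z (τ + 1)) := by
    rw [h.lam_succ]; abel
  have hz : z τ - P.T y₀ = (z (τ + 1) - P.T y₀) - (z (τ + 1) - z τ) := by abel
  have hd := mul_nonneg P.ρ_pos.le (nonneg_G (P := P) (z (τ + 1) - z τ))
  rw [lyapunov, lyapunov, hlam, hz]
  generalize P.T (y τ) - z (τ + 1) = r at *
  generalize z (τ + 1) - P.T y₀ = p at *
  generalize z (τ + 1) - z τ = d at *
  generalize lam τ - lam₀ = m at *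
  generalize y τ - y₀ = e at *
  simp only [map_add, map_sub, map_smul, LinearMap.add_apply, LinearMap.smul_apply,
    LinearMap.sub_apply, smul_eq_mul]
  rw [P.isSymm_G.eq d p] at hmono ⊢
  rw [P.isSymm_G.eq r m]
  have hρ : P.ρ⁻¹ * (P.G m m + P.ρ * P.G m r + P.ρ * (P.G m r + P.ρ * P.G r r))
      = P.ρ⁻¹ * P.G m m + (2 * P.G m r + P.ρ * P.G r r) := by
    field_simp [P.ρ_pos.ne']
    ring
  rw [hρ]
  linarith

theorem IsADMM.tendsto_lyapunov_sub (h : P.IsADMM y z lam) (hC : Convex ℝ P.C)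
    (h₀ : P.IsSaddlePoint y₀ lam₀) :
    Tendsto (fun τ => P.lyapunov y₀ lam₀ (lam τ) (z τ)
      - P.lyapunov y₀ lam₀ (lam (τ + 1)) (z (τ + 1))) atTop (𝓝 0) := by
  have hanti : Antitone fun τ => P.lyapunov y₀ lam₀ (lam τ) (z τ) :=
    antitone_nat_of_succ_le fun τ => by
      have hdescent := h.lyapunov_descent hC h₀ τ
      have hB := P.isPosSemidef_B.nonneg (y τ - y₀)
      have hG := mul_nonneg P.ρ_pos.le (nonneg_G (P := P) (P.T (y τ) - z (τ + 1)))
      linarith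
  have hlim := tendsto_atTop_ciInf hanti
    ⟨0, by rintro _ ⟨τ, rfl⟩; exact lyapunov_nonneg _ _ _ _⟩
  simpa using hlim.sub (hlim.comp (tendsto_add_atTop_nat 1))

theorem IsADMM.tendsto_error (h : P.IsADMM y z lam) (hC : Convex ℝ P.C)
    (h₀ : P.IsSaddlePoint y₀ lam₀) :
    Tendsto (fun τ => P.B (y τ - y₀) (y τ - y₀)) atTop (𝓝 0) := by
  refine squeeze_zero (fun τ => P.isPosSemidef_B.nonneg _) (fun τ => ?_)
    (h.tendsto_lyapunov_sub hC h₀)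
  have hdescent := h.lyapunov_descent hC h₀ τ
  have hB := P.isPosSemidef_B.nonneg (y τ - y₀)
  have hG := mul_nonneg P.ρ_pos.le (nonneg_G (P := P) (P.T (y τ) - z (τ + 1)))
  linarith

theorem IsADMM.tendsto_residual (h : P.IsADMM y z lam) (hC : Convex ℝ P.C)
    (h₀ : P.IsSaddlePoint y₀ lam₀) :
    Tendsto (fun τ => P.G (P.T (y τ) - z (τ + 1)) (P.T (y τ) - z (τ + 1))) atTop (𝓝 0) := by
  refine squeeze_zero (fun τ => nonneg_G _) (fun τ => ?_)
    (by simpa using (h.tendsto_lyapunov_sub hC h₀).const_mul P.ρ⁻¹)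
  rw [le_inv_mul_iff₀ P.ρ_pos]
  have hdescent := h.lyapunov_descent hC h₀ τ
  have hB := P.isPosSemidef_B.nonneg (y τ - y₀)
  linarith

end Convergence

theorem exists_isSaddlePoint [FiniteDimensional ℝ H] (hC : IsPolyhedral P.C) {y₀ : V}
    (hy₀ : y₀ ∈ P.C) (hTy₀ : P.T y₀ ∈ P.L)
    (hmin : IsMinOn (fun y => P.B y y) (P.C ∩ P.T ⁻¹' P.L) y₀) :
    ∃ lam₀, P.IsSaddlePoint y₀ lam₀ := by
  have hdir : ∀ y ∈ P.C, y - y₀ ∈ P.L.comap P.T → 0 ≤ ((2 : ℝ) • P.B y₀) (y - y₀) := by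
    intro y hy hL
    refine nonneg_of_forall_add_mul_nonneg (q := P.B (y - y₀) (y - y₀))
      fun t ht0 ht1 => nonneg_of_mul_nonneg_right ?_ ht0
    have hL' : P.T (y₀ + t • (y - y₀)) ∈ P.L := by
      rw [map_add, map_smul]
      exact P.L.add_mem hTy₀ (P.L.smul_mem t hL)
    have hle : P.B y₀ y₀ ≤ P.B (y₀ + t • (y - y₀)) (y₀ + t • (y - y₀)) :=
      hmin ⟨hC.convex.add_smul_sub_mem hy₀ hy ⟨ht0.le, ht1⟩, hL'⟩
    generalize y - y₀ = d at hle ⊢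
    simp only [map_add, map_smul, LinearMap.add_apply, LinearMap.smul_apply, smul_eq_mul] at hle ⊢
    rw [P.isPosSemidef_B.isSymm.eq d y₀] at hle
    linarith
  obtain ⟨ν, hν, hνmin⟩ := hC.exists_multiplier _ _ hy₀ hdir
  obtain ⟨φ, hφ⟩ : ∃ φ : Module.Dual ℝ (H ⧸ P.L), φ ∘ₗ P.L.mkQ ∘ₗ P.T = ν := by
    rwa [← P.L.ker_mkQ, ← LinearMap.ker_comp,
      ← LinearMap.range_dualMap_eq_dualAnnihilator_ker] at hν
  refine ⟨(P.G.toDual nondegenerate_G).symm (φ ∘ₗ P.L.mkQ), hy₀, hTy₀, fun w hw => ?_,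
    fun y hy => ?_⟩ <;>
    rw [LinearMap.BilinForm.apply_toDual_symm_apply]
  · rw [LinearMap.comp_apply, P.L.mkQ_apply, (Submodule.Quotient.mk_eq_zero _).2 hw, map_zero]
  · rw [← hφ] at hνmin
    exact hνmin y hy

end Algebraic

theorem IsADMM.tendsto_inv_smul_lam {V H : Type*} [AddCommGroup V] [Module ℝ V]
    [NormedAddCommGroup H] [NormedSpace ℝ H] {P : ConsensusProblem V H}
    {y : ℕ → V} {z lam : ℕ → H} (h : P.IsADMM y z lam) {r : H}
    (hr : Tendsto (fun τ => P.T (y τ) - z (τ + 1)) atTop (𝓝 r)) :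
    Tendsto (fun τ : ℕ => (τ : ℝ)⁻¹ • lam τ) atTop (𝓝 (P.ρ • r)) := by
  have hsum := ((tendsto_inv_atTop_nhds_zero_nat (𝕜 := ℝ)).smul_const (lam 0)).add
    (hr.cesaro_smul.const_smul P.ρ)
  rw [zero_smul, zero_add] at hsum
  refine hsum.congr fun τ => ?_
  rw [h.lam_eq_add_sum τ, smul_add, smul_comm (τ : ℝ)⁻¹ P.ρ]

section Limit

variable {V H : Type*} [NormedAddCommGroup V] [NormedSpace ℝ V] [FiniteDimensional ℝ V]
  [NormedAddCommGroup H] [NormedSpace ℝ H] [FiniteDimensional ℝ H] {P : ConsensusProblem V H}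

/-- The multipliers grow like `τ • ρ • r` for the limit `r` of the residuals, and a competitor that
satisfies the consensus constraint only permits this growth if `r = 0`. -/
theorem IsADMM.map_limit_eq {y : ℕ → V} {z lam : ℕ → H} (h : P.IsADMM y z lam) {y' : V} {z' : H}
    (hy : Tendsto y atTop (𝓝 y')) (hz : Tendsto z atTop (𝓝 z'))
    (hne : (P.C ∩ P.T ⁻¹' P.L).Nonempty) : P.T y' = z' := by
  obtain ⟨w, hwC, hwL⟩ := hne
  have hT : Tendsto (fun τ => P.T (y τ)) atTop (𝓝 (P.T y')) :=
    (P.T.continuous_of_finiteDimensional.tendsto y').comp hy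
  have hz₁ : Tendsto (fun τ => z (τ + 1)) atTop (𝓝 z') := hz.comp (tendsto_add_atTop_nat 1)
  have hr := hT.sub hz₁
  have horth : P.G (P.T y' - z') z' = 0 :=
    tendsto_nhds_unique (tendsto_bilinForm_apply P.G hr hz₁)
      (by simp only [h.residual_orthogonal _ (h.z_mem _), tendsto_const_nhds])
  have hinv := tendsto_inv_atTop_nhds_zero_nat (𝕜 := ℝ)
  have hlam := h.tendsto_inv_smul_lam hr
  have hbound : ∀ τ : ℕ, P.G ((τ : ℝ)⁻¹ • lam τ) (P.T (y τ))
      ≤ (τ : ℝ)⁻¹ * (P.B w w + P.ρ / 2 * P.G (P.T w - z τ) (P.T w - z τ)) := fun τ => by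
    have hle : P.augLagrangian (lam τ) (z τ) (y τ) ≤ P.augLagrangian (lam τ) (z τ) w :=
      h.y_min τ hwC
    have hB := P.isPosSemidef_B.nonneg (y τ)
    have hG := mul_nonneg P.ρ_pos.le (nonneg_G (P := P) (P.T (y τ) - z τ))
    rw [augLagrangian, augLagrangian, h.lam_orthogonal τ _ hwL] at hle
    rw [map_smul, LinearMap.smul_apply, smul_eq_mul]
    exact mul_le_mul_of_nonneg_left (by linarith) (by positivity)
  have hcomp : Tendsto (fun τ => P.T w - z τ) atTop (𝓝 (P.T w - z')) := hz.const_sub _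
  have hle := le_of_tendsto_of_tendsto' (tendsto_bilinForm_apply P.G hlam hT)
    (hinv.mul ((tendsto_bilinForm_apply P.G hcomp hcomp).const_mul (P.ρ / 2) |>.const_add
      (P.B w w))) hbound
  rw [zero_mul, map_smul, LinearMap.smul_apply, smul_eq_mul] at hle
  by_contra hne
  have hpos := mul_pos P.ρ_pos (P.pos_G _ (sub_ne_zero.2 hne))
  rw [map_sub, horth, sub_zero] at hpos
  exact hpos.not_ge hle

end Limit

end ConsensusProblem

/-! ### Coercivity -/

section Homogeneous

variable {E : Type*} [NormedAddCommGroup E] [NormedSpace ℝ E] {q : E → ℝ}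

theorem apply_zero_of_homogeneous (hhom : ∀ (t : ℝ) v, q (t • v) = t ^ 2 * q v) : q 0 = 0 := by
  simpa using hhom 0 0

theorem apply_inv_norm_smul_of_homogeneous (hhom : ∀ (t : ℝ) v, q (t • v) = t ^ 2 * q v) {v : E}
    (hv : v ≠ 0) : q (‖v‖⁻¹ • v) * ‖v‖ ^ 2 = q v := by
  rw [mul_comm, ← hhom, smul_inv_smul₀ (norm_ne_zero_iff.2 hv)]

theorem inv_norm_smul_mem_sphere {v : E} (hv : v ≠ 0) : ‖v‖⁻¹ • v ∈ Metric.sphere (0 : E) 1 := by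
  rw [mem_sphere_zero_iff_norm, norm_smul, norm_inv, norm_norm,
    inv_mul_cancel₀ (norm_ne_zero_iff.2 hv)]

variable [FiniteDimensional ℝ E]

theorem exists_mul_sq_norm_le (hq : Continuous q)
    (hhom : ∀ (t : ℝ) v, q (t • v) = t ^ 2 * q v) (hpos : ∀ v, v ≠ 0 → 0 < q v) :
    ∃ a > 0, ∀ v, a * ‖v‖ ^ 2 ≤ q v := by
  have := FiniteDimensional.proper ℝ E
  rcases subsingleton_or_nontrivial E with hE | hE
  · exact ⟨1, one_pos, fun v => by
      simp [Subsingleton.elim v 0, apply_zero_of_homogeneous hhom]⟩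
  obtain ⟨e, he, hmin⟩ := (isCompact_sphere (0 : E) 1).exists_isMinOn
    (NormedSpace.sphere_nonempty.2 zero_le_one) hq.continuousOn
  refine ⟨q e, hpos e (ne_zero_of_mem_unit_sphere ⟨e, he⟩), fun v => ?_⟩
  rcases eq_or_ne v 0 with rfl | hv
  · simp [apply_zero_of_homogeneous hhom]
  · rw [← apply_inv_norm_smul_of_homogeneous hhom hv]
    exact mul_le_mul_of_nonneg_right (hmin (inv_norm_smul_mem_sphere hv)) (sq_nonneg _)

theorem exists_le_mul_sq_norm (hq : Continuous q)
    (hhom : ∀ (t : ℝ) v, q (t • v) = t ^ 2 * q v) : ∃ b, ∀ v, q v ≤ b * ‖v‖ ^ 2 := by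
  have := FiniteDimensional.proper ℝ E
  obtain ⟨b, hb⟩ := (isCompact_sphere (0 : E) 1).bddAbove_image hq.continuousOn
  refine ⟨b, fun v => ?_⟩
  rcases eq_or_ne v 0 with rfl | hv
  · simp [apply_zero_of_homogeneous hhom]
  · rw [← apply_inv_norm_smul_of_homogeneous hhom hv]
    exact mul_le_mul_of_nonneg_right (hb ⟨_, inv_norm_smul_mem_sphere hv, rfl⟩) (sq_nonneg _)

theorem exists_isMinOn_of_sq_norm_sub_le {C : Set E} (hC : IsClosed C) (hne : C.Nonempty)
    {g : E → ℝ} (hg : Continuous g) {a b : ℝ} (ha : 0 < a)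
    (h : ∀ y ∈ C, a * ‖y‖ ^ 2 - b * ‖y‖ ≤ g y) : ∃ y ∈ C, IsMinOn g C y := by
  have := FiniteDimensional.proper ℝ E
  obtain ⟨y₁, hy₁⟩ := hne
  refine hg.continuousOn.exists_isMinOn' hC hy₁ (eventually_inf_principal.2 ?_)
  have hgrowth : Tendsto (fun y : E => ‖y‖ * (a * ‖y‖ - b)) (cocompact E) atTop :=
    tendsto_norm_cocompact_atTop.atTop_mul_atTop₀ (tendsto_atTop_add_const_right _ (-b)
      (tendsto_norm_cocompact_atTop.const_mul_atTop ha))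
  filter_upwards [hgrowth.eventually_ge_atTop (g y₁)] with y hy hyC
  linarith [h y hyC]

end Homogeneous

namespace ConsensusProblem

variable {V H : Type*} [NormedAddCommGroup V] [NormedSpace ℝ V] [FiniteDimensional ℝ V]
  [NormedAddCommGroup H] [NormedSpace ℝ H] [FiniteDimensional ℝ H]

/-- The objective of the consensus problem is positive definite on the consensus constraint; then
the problem and the minimizations in the method of multipliers are coercive. -/
def IsDefinite (P : ConsensusProblem V H) : Prop :=
  ∀ y, P.T y ∈ P.L → P.B y y = 0 → y = 0

variable {P : ConsensusProblem V H}

theorem IsDefinite.exists_mul_sq_norm_le (hP : P.IsDefinite) {c : ℝ} (hc : 0 < c) :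
    ∃ a > 0, ∀ y, ∀ z ∈ P.L, a * ‖y‖ ^ 2 ≤ P.B y y + c * P.G (P.T y - z) (P.T y - z) := by
  have hT : Continuous P.T := P.T.continuous_of_finiteDimensional
  have hcont : Continuous fun p : V × P.L =>
      P.B p.1 p.1 + c * P.G (P.T p.1 - p.2) (P.T p.1 - p.2) :=
    ((continuous_bilinForm P.B).comp (by fun_prop : Continuous fun p : V × P.L => (p.1, p.1))).add
      (continuous_const.mul ((continuous_bilinForm P.G).comp
        (by fun_prop : Continuous fun p : V × P.L => (P.T p.1 - (p.2 : H), P.T p.1 - (p.2 : H)))))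
  have hpos : ∀ p : V × P.L, p ≠ 0 →
      0 < P.B p.1 p.1 + c * P.G (P.T p.1 - p.2) (P.T p.1 - p.2) := by
    rintro ⟨y, z⟩ hp
    have hB := P.isPosSemidef_B.nonneg y
    have hG := mul_nonneg hc.le (nonneg_G (P := P) (P.T y - z))
    refine (add_nonneg hB hG).lt_of_ne fun hzero => hp ?_
    have hTy : P.T y = z := by
      by_contra hne
      linarith [mul_pos hc (P.pos_G _ (sub_ne_zero.2 hne))]
    obtain rfl : y = 0 := hP y (hTy ▸ z.2) (by linarith)
    exact Prod.ext rfl (Subtype.ext (by rw [← hTy, map_zero]; rfl))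
  obtain ⟨a, ha, h⟩ := _root_.exists_mul_sq_norm_le hcont (fun t p => by
    simp only [Prod.smul_fst, Prod.smul_snd, Submodule.coe_smul, map_smul, LinearMap.smul_apply,
      smul_eq_mul, ← smul_sub]
    ring) hpos
  refine ⟨a, ha, fun y z hz => le_trans ?_ (h (y, ⟨z, hz⟩))⟩
  gcongr
  exact norm_fst_le (y, (⟨z, hz⟩ : P.L))

theorem IsDefinite.exists_isMinOn (hP : P.IsDefinite) (hC : IsClosed P.C)
    (hne : (P.C ∩ P.T ⁻¹' P.L).Nonempty) :
    ∃ y₀ ∈ P.C ∩ P.T ⁻¹' P.L, IsMinOn (fun y => P.B y y) (P.C ∩ P.T ⁻¹' P.L) y₀ := by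
  obtain ⟨a, ha, h⟩ := hP.exists_mul_sq_norm_le one_pos
  refine exists_isMinOn_of_sq_norm_sub_le (b := 0)
    (hC.inter (P.L.closed_of_finiteDimensional.preimage P.T.continuous_of_finiteDimensional)) hne
    ((continuous_bilinForm P.B).comp (continuous_id.prodMk continuous_id)) ha fun y hy => ?_
  simpa using h y _ hy.2

theorem continuous_augLagrangian (lam z : H) : Continuous (P.augLagrangian lam z) := by
  have hT : Continuous P.T := P.T.continuous_of_finiteDimensional
  exact (((continuous_bilinForm P.B).comp (continuous_id.prodMk continuous_id)).add
    ((continuous_bilinForm P.G).comp (continuous_const.prodMk hT))).add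
    (continuous_const.mul ((continuous_bilinForm P.G).comp
      ((hT.sub continuous_const).prodMk (hT.sub continuous_const))))

theorem IsDefinite.exists_isMinOn_augLagrangian (hP : P.IsDefinite) (hC : IsClosed P.C)
    (hne : P.C.Nonempty) (lam : H) {z : H} (hz : z ∈ P.L) :
    ∃ y ∈ P.C, IsMinOn (P.augLagrangian lam z) P.C y := by
  obtain ⟨a, ha, h⟩ := hP.exists_mul_sq_norm_le (half_pos P.ρ_pos)
  let φ : V →L[ℝ] ℝ := (P.G lam ∘ₗ P.T).toContinuousLinearMap
  refine exists_isMinOn_of_sq_norm_sub_le (b := ‖φ‖) hC hne (continuous_augLagrangian lam z) ha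
    fun y _ => ?_
  have hφ : -(‖φ‖ * ‖y‖) ≤ P.G lam (P.T y) := (abs_le.1 (φ.le_opNorm y)).1
  rw [augLagrangian]
  linarith [h y z hz]

theorem IsADMM.tendsto (hP : P.IsDefinite) (hC : Convex ℝ P.C) {y : ℕ → V} {z lam : ℕ → H}
    (h : P.IsADMM y z lam) {y₀ : V} {lam₀ : H} (h₀ : P.IsSaddlePoint y₀ lam₀) :
    Tendsto y atTop (𝓝 y₀) := by
  obtain ⟨a, ha, hcoercive⟩ := hP.exists_mul_sq_norm_le one_pos
  have hlim := ((h.tendsto_error hC h₀).add (h.tendsto_residual hC h₀)).const_mul a⁻¹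
  rw [add_zero, mul_zero] at hlim
  have hsq : Tendsto (fun τ => ‖y τ - y₀‖ ^ 2) atTop (𝓝 0) := by
    refine squeeze_zero (fun τ => sq_nonneg _) (fun τ => ?_) hlim
    have hτ := hcoercive (y τ - y₀) _ (P.L.sub_mem (h.z_mem (τ + 1)) h₀.map_mem)
    rw [map_sub P.T, sub_sub_sub_cancel_right, one_mul] at hτ
    rwa [le_inv_mul_iff₀ ha]
  rw [tendsto_iff_norm_sub_tendsto_zero]
  simpa using hsq.sqrt

theorem IsADMM.exists_tendsto (hP : P.IsDefinite) (hC : IsPolyhedral P.C)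
    (hne : (P.C ∩ P.T ⁻¹' P.L).Nonempty) {y : ℕ → V} {z lam : ℕ → H} (h : P.IsADMM y z lam) :
    ∃ y', Tendsto y atTop (𝓝 y') := by
  obtain ⟨y₀, ⟨hy₀, hTy₀⟩, hmin⟩ := hP.exists_isMinOn hC.isClosed hne
  obtain ⟨lam₀, h₀⟩ := exists_isSaddlePoint hC hy₀ hTy₀ hmin
  exact ⟨y₀, h.tendsto hP hC.convex h₀⟩

end ConsensusProblem

/-! ### Exponential decay -/

section ExponentialDecay

variable {E : Type*} [NormedAddCommGroup E]

theorem norm_le_of_lyapunov_decrease {V : E → ℝ} {a a' b : ℝ} (ha : 0 < a) (ha' : 0 < a')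
    (hab : a ≤ b) (hlower : ∀ v, a' * ‖v‖ ^ 2 ≤ V v) (hupper : ∀ v, V v ≤ b * ‖v‖ ^ 2)
    {x : ℕ → E} (hx : ∀ t, V (x (t + 1)) + a * ‖x t‖ ^ 2 ≤ V (x t)) (t : ℕ) :
    ‖x t‖ ≤ √(b / a') * √(1 - a / b) ^ t * ‖x 0‖ := by
  have hb : 0 < b := ha.trans_le hab
  have hκ : 0 ≤ 1 - a / b := sub_nonneg.2 ((div_le_one hb).2 hab)
  have hstep : ∀ k, V (x (k + 1)) ≤ (1 - a / b) * V (x k) := fun k => by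
    have hle : a / b * V (x k) ≤ a * ‖x k‖ ^ 2 :=
      calc a / b * V (x k) ≤ a / b * (b * ‖x k‖ ^ 2) := by gcongr; exact hupper _
        _ = a * ‖x k‖ ^ 2 := by field_simp
    linarith [hx k]
  have hV : V (x t) ≤ (1 - a / b) ^ t * V (x 0) :=
    le_geom (u := fun k => V (x k)) hκ t fun k _ => hstep k
  refine (sq_le_sq₀ (norm_nonneg _) (by positivity)).1 ?_
  calc ‖x t‖ ^ 2 ≤ V (x t) / a' := by rw [le_div_iff₀' ha']; exact hlower _
    _ ≤ (1 - a / b) ^ t * (b * ‖x 0‖ ^ 2) / a' := by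
      gcongr
      exact hV.trans (mul_le_mul_of_nonneg_left (hupper _) (pow_nonneg hκ t))
    _ = (√(b / a') * √(1 - a / b) ^ t * ‖x 0‖) ^ 2 := by
      rw [mul_pow, mul_pow, ← pow_mul, mul_comm t 2, pow_mul, Real.sq_sqrt hκ,
        Real.sq_sqrt (by positivity)]
      ring

theorem exists_norm_le_of_lyapunov_decrease {V : E → ℝ} {a a' b : ℝ} (ha : 0 < a) (ha' : 0 < a')
    (hlower : ∀ v, a' * ‖v‖ ^ 2 ≤ V v) (hupper : ∀ v, V v ≤ b * ‖v‖ ^ 2) :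
    ∃ γ : ℝ, 0 < γ ∧ γ < 1 ∧ ∃ C : ℝ, 1 ≤ C ∧ ∀ x : ℕ → E,
      (∀ t, V (x (t + 1)) + a * ‖x t‖ ^ 2 ≤ V (x t)) → ∀ t, ‖x t‖ ≤ C * γ ^ t * ‖x 0‖ := by
  set b' := |b| + a + a'
  have hab' : a < b' := by linarith [abs_nonneg b]
  have ha'b' : a' ≤ b' := by linarith [abs_nonneg b]
  have hpos : 0 < b' := ha.trans hab'
  refine ⟨√(1 - a / b'), ?_, ?_, √(b' / a'), ?_, fun x => norm_le_of_lyapunov_decrease ha ha'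
    hab'.le hlower fun v => (hupper v).trans ?_⟩
  · rwa [Real.sqrt_pos, sub_pos, div_lt_one hpos]
  · rw [Real.sqrt_lt' one_pos, one_pow]
    linarith [div_pos ha hpos]
  · rwa [Real.one_le_sqrt, one_le_div ha']
  · gcongr
    linarith [le_abs_self b]

theorem norm_le_of_decay_from {x : ℕ → E} {γ C R δ : ℝ} (hγ₀ : 0 < γ) (hγ₁ : γ ≤ 1) (hC : 1 ≤ C)
    (hδ : 0 < δ) {T T₀ : ℕ} (hT : T ≤ T₀) (hR : ∀ t ≤ T, ‖x t‖ ≤ R)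
    (hdecay : ∀ t, ‖x (T + t)‖ ≤ C * γ ^ t * ‖x T‖) (hx₀ : δ ≤ ‖x 0‖) (t : ℕ) :
    ‖x t‖ ≤ C * R / (δ * γ ^ T₀) * γ ^ t * ‖x 0‖ := by
  have hR₀ : 0 ≤ R := (norm_nonneg _).trans (hR 0 (Nat.zero_le T))
  have hscaled : ‖x t‖ * γ ^ T₀ ≤ C * R * γ ^ t := by
    rcases le_total t T with ht | ht
    · have hpow : γ ^ T₀ ≤ γ ^ t := pow_le_pow_of_le_one hγ₀.le hγ₁ (ht.trans hT)
      calc ‖x t‖ * γ ^ T₀ ≤ R * γ ^ t := by gcongr; exact hR t ht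
        _ ≤ C * R * γ ^ t := by gcongr; exact le_mul_of_one_le_left hR₀ hC
    · obtain ⟨d, rfl⟩ := Nat.exists_eq_add_of_le ht
      have hpow : γ ^ T₀ ≤ γ ^ T := pow_le_pow_of_le_one hγ₀.le hγ₁ hT
      calc ‖x (T + d)‖ * γ ^ T₀ ≤ (C * γ ^ d * R) * γ ^ T := by
            gcongr
            exact (hdecay d).trans (by gcongr; exact hR T le_rfl)
        _ = C * R * γ ^ (T + d) := by ring
  calc ‖x t‖ ≤ C * R * γ ^ t / γ ^ T₀ := (le_div_iff₀ (by positivity)).2 hscaled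
    _ = C * R / (δ * γ ^ T₀) * γ ^ t * δ := by field_simp
    _ ≤ C * R / (δ * γ ^ T₀) * γ ^ t * ‖x 0‖ := by gcongr

end ExponentialDecay

/-! ### Quadratic costs of predicted trajectories -/

theorem isPosSemidef_sum {V ι : Type*} [AddCommGroup V] [Module ℝ V] {s : Finset ι}
    {B : ι → LinearMap.BilinForm ℝ V} (hB : ∀ i ∈ s, (B i).IsPosSemidef) :
    (∑ i ∈ s, B i).IsPosSemidef :=
  Finset.sum_induction B (fun B => B.IsPosSemidef) (fun _ _ => LinearMap.BilinForm.IsPosSemidef.add)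
    LinearMap.BilinForm.isPosSemidef_zero hB

theorem isPosSemidef_comp_self {V W : Type*} [AddCommGroup V] [Module ℝ V] [AddCommGroup W]
    [Module ℝ W] {B : LinearMap.BilinForm ℝ W} (hB : B.IsPosSemidef) (f : V →ₗ[ℝ] W) :
    (B.comp f f).IsPosSemidef where
  eq v w := hB.eq (f v) (f w)
  nonneg v := hB.nonneg (f v)

theorem isPosSemidef_toBilin' {ι : Type*} [Fintype ι] [DecidableEq ι] {Q : Matrix ι ι ℝ}
    (hQ : Q.PosSemidef) : (Matrix.toBilin' Q).IsPosSemidef where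
  eq := (Matrix.isSymm_toBilin'_iff_isSymm.2 hQ.isHermitian).eq
  nonneg v := by
    rw [Matrix.toBilin'_apply']
    exact hQ.dotProduct_mulVec_nonneg v

theorem isMinOn_sum_iff {ι : Type*} [Fintype ι] {α : ι → Type*} {C : ∀ i, Set (α i)}
    {g : ∀ i, α i → ℝ} {y : ∀ i, α i} (hy : ∀ i, y i ∈ C i) :
    IsMinOn (fun y => ∑ i, g i (y i)) {y | ∀ i, y i ∈ C i} y ↔
      ∀ i, IsMinOn (g i) (C i) (y i) := by
  classical
  refine ⟨fun h i => isMinOn_iff.2 fun w hw => ?_, fun h => isMinOn_iff.2 fun w hw =>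
    Finset.sum_le_sum fun i _ => isMinOn_iff.1 (h i) (w i) (hw i)⟩
  have hle := isMinOn_iff.1 h (Function.update y i w) fun j => by
    rcases eq_or_ne j i with rfl | hj
    · simpa only [Function.update_self] using hw
    · simpa only [Function.update_of_ne hj] using hy j
  have hrest : ∑ j ∈ Finset.univ.erase i, g j (Function.update y i w j)
      = ∑ j ∈ Finset.univ.erase i, g j (y j) :=
    Finset.sum_congr rfl fun j hj => by rw [Function.update_of_ne (Finset.ne_of_mem_erase hj)]
  rwa [← Finset.add_sum_erase _ _ (Finset.mem_univ i),
    ← Finset.add_sum_erase _ (fun j => g j (Function.update y i w j)) (Finset.mem_univ i),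
    hrest, Function.update_self, add_le_add_iff_right] at hle

noncomputable section

namespace MPCDesign

variable {M : ℕ} {S : PWANetwork M}

section Costs

variable (D : MPCDesign S)

/-- The predicted state of subsystem `i` at stage `k` as a linear function. -/
def ownMap (i : Fin M) (k : Fin (D.N + 1)) : D.LocVar i →ₗ[ℝ] S.St i :=
  LinearMap.proj k ∘ₗ LinearMap.fst ℝ _ _ ∘ₗ LinearMap.fst ℝ _ _

/-- The copy of the state of the neighbour `j` at stage `k` as a linear function. -/
def copyMap (i : Fin M) (j : S.nbr i) (k : Fin (D.N + 1)) : D.LocVar i →ₗ[ℝ] S.St j :=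
  LinearMap.proj k ∘ₗ LinearMap.proj j ∘ₗ LinearMap.snd ℝ _ _ ∘ₗ LinearMap.fst ℝ _ _

/-- The input of subsystem `i` at stage `k` as a linear function. -/
def inpMap (i : Fin M) (k : Fin D.N) : D.LocVar i →ₗ[ℝ] S.Inp i :=
  LinearMap.proj k ∘ₗ LinearMap.snd ℝ _ _

/-- The bilinear form of the local cost. -/
def costForm (i : Fin M) : LinearMap.BilinForm ℝ (D.LocVar i) :=
  ∑ k : Fin D.N,
    ((Matrix.toBilin' (D.Q i)).comp (D.ownMap i k.castSucc) (D.ownMap i k.castSucc)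
      + (Matrix.toBilin' (D.R i)).comp (D.inpMap i k) (D.inpMap i k)
      + ∑ j, (Matrix.toBilin' (D.Qc i j)).comp (D.copyMap i j k.castSucc)
          (D.copyMap i j k.castSucc))
    + (Matrix.toBilin' (D.Φ i)).comp (D.ownMap i (Fin.last _)) (D.ownMap i (Fin.last _))

/-- The bilinear form of the global cost. -/
def totalForm : LinearMap.BilinForm ℝ D.Var :=
  ∑ i, (D.costForm i).comp (LinearMap.proj i) (LinearMap.proj i)

theorem costForm_self (i : Fin M) (y : D.LocVar i) : D.costForm i y y = D.cost i y := by
  simp only [costForm, cost, stage, Vf, LinearMap.add_apply, LinearMap.sum_apply,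
    LinearMap.BilinForm.comp_apply, Matrix.toBilin'_apply']
  rfl

theorem totalForm_self (y : D.Var) : D.totalForm y y = ∑ i, D.cost i (y i) := by
  simp only [totalForm, LinearMap.sum_apply, LinearMap.BilinForm.comp_apply, LinearMap.proj_apply,
    costForm_self]

theorem continuous_totalForm_self : Continuous fun y : D.Var => D.totalForm y y :=
  (continuous_bilinForm D.totalForm).comp (continuous_id.prodMk continuous_id)

/-- The global stage cost. -/
def totalStage (x : S.State) (u : S.Input) : ℝ := ∑ i, D.stage i (x i) (u i) (S.nbrState x i)

/-- The global terminal cost. -/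
def totalVf (x : S.State) : ℝ := ∑ i, D.Vf i (x i)

end Costs

theorem continuous_sum_dotProduct (Q : ∀ i, Matrix (Fin (S.n i)) (Fin (S.n i)) ℝ) :
    Continuous fun x : S.State => ∑ i, x i ⬝ᵥ Q i *ᵥ x i := by
  simp only [dotProduct, mulVec]
  fun_prop

theorem sum_dotProduct_smul (Q : ∀ i, Matrix (Fin (S.n i)) (Fin (S.n i)) ℝ) (t : ℝ)
    (x : S.State) :
    ∑ i, (t • x) i ⬝ᵥ Q i *ᵥ (t • x) i = t ^ 2 * ∑ i, x i ⬝ᵥ Q i *ᵥ x i := by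
  simp only [Pi.smul_apply, mulVec_smul, smul_dotProduct, dotProduct_smul, smul_eq_mul,
    Finset.mul_sum, pow_two, mul_assoc]

theorem sum_dotProduct_pos {Q : ∀ i, Matrix (Fin (S.n i)) (Fin (S.n i)) ℝ}
    (hQ : ∀ i, (Q i).PosDef) {x : S.State} (hx : x ≠ 0) : 0 < ∑ i, x i ⬝ᵥ Q i *ᵥ x i := by
  obtain ⟨i, hi⟩ := Function.ne_iff.1 hx
  exact Finset.sum_pos' (fun j _ => (hQ j).posSemidef.dotProduct_mulVec_nonneg _)
    ⟨i, Finset.mem_univ _, (hQ i).dotProduct_mulVec_pos hi⟩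

theorem exists_mul_sq_norm_le_sum_dotProduct {Q : ∀ i, Matrix (Fin (S.n i)) (Fin (S.n i)) ℝ}
    (hQ : ∀ i, (Q i).PosDef) : ∃ a > 0, ∀ x : S.State, a * ‖x‖ ^ 2 ≤ ∑ i, x i ⬝ᵥ Q i *ᵥ x i :=
  exists_mul_sq_norm_le (continuous_sum_dotProduct Q) (sum_dotProduct_smul Q)
    fun _ => sum_dotProduct_pos hQ

theorem exists_totalVf_le_mul_sq_norm (D : MPCDesign S) :
    ∃ b, ∀ x, D.totalVf x ≤ b * ‖x‖ ^ 2 :=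
  exists_le_mul_sq_norm (continuous_sum_dotProduct D.Φ) (sum_dotProduct_smul D.Φ)

namespace CostAssumption

variable {D : MPCDesign S} (hcost : D.CostAssumption)

include hcost

theorem isPosSemidef_totalForm : D.totalForm.IsPosSemidef := by
  refine isPosSemidef_sum fun i _ => isPosSemidef_comp_self (.add (isPosSemidef_sum fun k _ =>
    .add (.add ?_ ?_) (isPosSemidef_sum fun j _ => ?_)) ?_) _
  · exact isPosSemidef_comp_self (isPosSemidef_toBilin' (hcost.posDef_Q i).posSemidef) _
  · exact isPosSemidef_comp_self (isPosSemidef_toBilin' (hcost.posDef_R i).posSemidef) _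
  · exact isPosSemidef_comp_self (isPosSemidef_toBilin' (hcost.posSemidef_Qc i j)) _
  · exact isPosSemidef_comp_self (isPosSemidef_toBilin' (hcost.posDef_Φ i).posSemidef) _

theorem quadratic_le_stage (i : Fin M) (x : S.St i) (u : S.Inp i)
    (xn : ∀ j : S.nbr i, S.St j) : x ⬝ᵥ D.Q i *ᵥ x + u ⬝ᵥ D.R i *ᵥ u ≤ D.stage i x u xn :=
  le_add_of_nonneg_right
    (Finset.sum_nonneg fun j _ => (hcost.posSemidef_Qc i j).dotProduct_mulVec_nonneg _)

theorem stage_nonneg (i : Fin M) (x : S.St i) (u : S.Inp i) (xn : ∀ j : S.nbr i, S.St j) :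
    0 ≤ D.stage i x u xn :=
  (add_nonneg ((hcost.posDef_Q i).posSemidef.dotProduct_mulVec_nonneg x)
    ((hcost.posDef_R i).posSemidef.dotProduct_mulVec_nonneg u)).trans
      (hcost.quadratic_le_stage i x u xn)

theorem eq_zero_of_stage_eq_zero {i : Fin M} {x : S.St i} {u : S.Inp i}
    {xn : ∀ j : S.nbr i, S.St j} (h : D.stage i x u xn = 0) : x = 0 ∧ u = 0 := by
  have hle := hcost.quadratic_le_stage i x u xn
  have hQ : 0 ≤ x ⬝ᵥ D.Q i *ᵥ x := (hcost.posDef_Q i).posSemidef.dotProduct_mulVec_nonneg x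
  have hR : 0 ≤ u ⬝ᵥ D.R i *ᵥ u := (hcost.posDef_R i).posSemidef.dotProduct_mulVec_nonneg u
  constructor <;> by_contra hne
  · have hpos : 0 < x ⬝ᵥ D.Q i *ᵥ x := (hcost.posDef_Q i).dotProduct_mulVec_pos hne
    linarith
  · have hpos : 0 < u ⬝ᵥ D.R i *ᵥ u := (hcost.posDef_R i).dotProduct_mulVec_pos hne
    linarith

theorem Vf_nonneg (i : Fin M) (x : S.St i) : 0 ≤ D.Vf i x :=
  (hcost.posDef_Φ i).posSemidef.dotProduct_mulVec_nonneg x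

theorem cost_nonneg (i : Fin M) (y : D.LocVar i) : 0 ≤ D.cost i y :=
  add_nonneg (Finset.sum_nonneg fun _ _ => hcost.stage_nonneg i _ _ _) (hcost.Vf_nonneg i _)

theorem eq_zero_of_cost_eq_zero {i : Fin M} {y : D.LocVar i} (h : D.cost i y = 0) :
    LocVar.own y = 0 ∧ LocVar.inp y = 0 := by
  obtain ⟨hsum, hVf⟩ := (add_eq_zero_iff_of_nonneg
    (Finset.sum_nonneg fun _ _ => hcost.stage_nonneg i _ _ _) (hcost.Vf_nonneg i _)).1 h
  rw [Finset.sum_eq_zero_iff_of_nonneg fun _ _ => hcost.stage_nonneg i _ _ _] at hsum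
  have hstage := fun k => hcost.eq_zero_of_stage_eq_zero (hsum k (Finset.mem_univ k))
  refine ⟨funext fun k => ?_, funext fun k => (hstage k).2⟩
  induction k using Fin.lastCases with
  | last => exact by_contra fun hne => ((hcost.posDef_Φ i).dotProduct_mulVec_pos hne).ne' hVf
  | cast k => exact (hstage k).1

theorem exists_mul_sq_norm_le_totalStage : ∃ a > 0, ∀ x u, a * ‖x‖ ^ 2 ≤ D.totalStage x u := by
  obtain ⟨a, ha, hle⟩ := exists_mul_sq_norm_le_sum_dotProduct hcost.posDef_Q
  refine ⟨a, ha, fun x u => (hle x).trans (Finset.sum_le_sum fun i _ => ?_)⟩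
  exact (le_add_of_nonneg_right ((hcost.posDef_R i).posSemidef.dotProduct_mulVec_nonneg _)).trans
    (hcost.quadratic_le_stage i _ _ _)

end CostAssumption

end MPCDesign

end

/-! ### Predicted trajectories in consensus -/

theorem PWANetwork.sum_nbr_comm {M : ℕ} (S : PWANetwork M) {α : Type*} [AddCommMonoid α]
    (b : ∀ i, S.nbr i → α) :
    ∑ i, ∑ j, b i j = ∑ i, ∑ j : {j // i ∈ S.nbr j}, b j ⟨i, j.2⟩ := by
  rw [Finset.sum_sigma', Finset.sum_sigma']
  exact Fintype.sum_equiv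
    { toFun := fun p : Σ i, S.nbr i => (⟨p.2.1, ⟨p.1, p.2.2⟩⟩ : Σ i, {j // i ∈ S.nbr j})
      invFun := fun p => ⟨p.2.1, ⟨p.1, p.2.2⟩⟩
      left_inv := fun _ => rfl
      right_inv := fun _ => rfl } _ _ fun _ => rfl

noncomputable section

namespace MPCDesign

variable {M : ℕ} {S : PWANetwork M} (D : MPCDesign S)

/-- The Euclidean inner product of global augmented trajectories as a bilinear form. -/
def augForm : LinearMap.BilinForm ℝ (∀ i, D.Aug i) :=
  ∑ i, (∑ k, (Matrix.toBilin' 1).comp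
      (LinearMap.proj k ∘ₗ LinearMap.fst ℝ _ _ ∘ₗ LinearMap.proj i)
      (LinearMap.proj k ∘ₗ LinearMap.fst ℝ _ _ ∘ₗ LinearMap.proj i)
    + ∑ j, ∑ k, (Matrix.toBilin' 1).comp
      (LinearMap.proj k ∘ₗ LinearMap.proj j ∘ₗ LinearMap.snd ℝ _ _ ∘ₗ LinearMap.proj i)
      (LinearMap.proj k ∘ₗ LinearMap.proj j ∘ₗ LinearMap.snd ℝ _ _ ∘ₗ LinearMap.proj i))

theorem augForm_apply (a b : ∀ i, D.Aug i) : D.augForm a b = ∑ i, D.augDot (a i) (b i) := by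
  simp only [augForm, augDot, LinearMap.sum_apply, LinearMap.add_apply,
    LinearMap.BilinForm.comp_apply, Matrix.toBilin'_apply', one_mulVec]
  rfl

theorem isSymm_augForm : D.augForm.IsSymm :=
  ⟨fun a b => by simp only [augForm_apply, augDot, dotProduct_comm]⟩

theorem augDot_self_nonneg {i : Fin M} (a : D.Aug i) : 0 ≤ D.augDot a a :=
  add_nonneg (Finset.sum_nonneg fun _ _ => dotProduct_self_star_nonneg _)
    (Finset.sum_nonneg fun _ _ => Finset.sum_nonneg fun _ _ => dotProduct_self_star_nonneg _)

theorem eq_zero_of_augDot_self_eq_zero {i : Fin M} {a : D.Aug i} (h : D.augDot a a = 0) :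
    a = 0 := by
  have hnonneg {n : ℕ} (v : Fin n → ℝ) : 0 ≤ v ⬝ᵥ v := dotProduct_self_star_nonneg v
  obtain ⟨hown, hcopy⟩ := (add_eq_zero_iff_of_nonneg (Finset.sum_nonneg fun _ _ => hnonneg _)
    (Finset.sum_nonneg fun _ _ => Finset.sum_nonneg fun _ _ => hnonneg _)).1 h
  simp only [Finset.sum_eq_zero_iff_of_nonneg, Finset.sum_nonneg, hnonneg, implies_true,
    Finset.mem_univ, forall_const, dotProduct_self_eq_zero] at hown hcopy
  exact Prod.ext (funext hown) (funext fun j => funext (hcopy j))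

theorem augForm_self_pos (a : ∀ i, D.Aug i) (ha : a ≠ 0) : 0 < D.augForm a a := by
  obtain ⟨i, hi⟩ := Function.ne_iff.1 ha
  rw [augForm_apply]
  exact Finset.sum_pos' (fun j _ => D.augDot_self_nonneg _) ⟨i, Finset.mem_univ i,
    (D.augDot_self_nonneg _).lt_of_ne' (mt D.eq_zero_of_augDot_self_eq_zero hi)⟩

/-- The augmented trajectories in a global decision variable. -/
def augMap : D.Var →ₗ[ℝ] ∀ i, D.Aug i :=
  LinearMap.pi fun i => LinearMap.fst ℝ _ _ ∘ₗ LinearMap.proj i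

/-- Distribution of a consensus variable to the subsystems. -/
def augOfMap : (∀ i, D.Traj i) →ₗ[ℝ] ∀ i, D.Aug i where
  toFun z i := D.augOf z i
  map_add' _ _ := rfl
  map_smul' _ _ := rfl

/-- The sum of all trajectories of a subsystem held in the network: its own and the copies. This
is the adjoint of `augOfMap`. -/
def collect : (∀ i, D.Aug i) →ₗ[ℝ] ∀ i, D.Traj i :=
  LinearMap.pi fun i => LinearMap.fst ℝ _ _ ∘ₗ LinearMap.proj i
    + ∑ j : {j // i ∈ S.nbr j},
      LinearMap.proj (⟨i, j.2⟩ : S.nbr j) ∘ₗ LinearMap.snd ℝ _ _ ∘ₗ LinearMap.proj j.1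

/-- The subspace of augmented trajectories that are in consensus. -/
def consensus : Submodule ℝ (∀ i, D.Aug i) := LinearMap.range D.augOfMap

theorem collect_apply (a : ∀ i, D.Aug i) (i : Fin M) :
    D.collect a i = (a i).1 + ∑ j : {j // i ∈ S.nbr j}, (a j).2 ⟨i, j.2⟩ := by
  simp only [collect, LinearMap.pi_apply, LinearMap.add_apply, LinearMap.sum_apply]
  rfl

theorem augForm_augOfMap (a : ∀ i, D.Aug i) (w : ∀ i, D.Traj i) :
    D.augForm a (D.augOfMap w) = ∑ i, ∑ k, D.collect a i k ⬝ᵥ w i k := by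
  have hcopy := S.sum_nbr_comm fun i j => ∑ k, (a i).2 j k ⬝ᵥ w j k
  rw [augForm_apply]
  simp only [augDot, Finset.sum_add_distrib]
  refine (congrArg _ hcopy).trans ?_
  simp only [← Finset.sum_add_distrib]
  refine Finset.sum_congr rfl fun i _ => ?_
  rw [Finset.sum_comm, ← Finset.sum_add_distrib]
  refine Finset.sum_congr rfl fun k _ => ?_
  have hsum : D.collect a i k = (a i).1 k + ∑ j : {j // i ∈ S.nbr j}, (a j).2 ⟨i, j.2⟩ k := by
    rw [collect_apply, Pi.add_apply]
    exact congrArg _ (Finset.sum_apply (M := fun _ => S.St i) k _ _)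
  rw [hsum, add_dotProduct]
  exact congrArg _ (sum_dotProduct (m := Fin (S.n i)) _ _ _).symm

theorem collect_augOfMap (z : ∀ i, D.Traj i) (i : Fin M) :
    D.collect (D.augOfMap z) i = ((Fintype.card {j // i ∈ S.nbr j} : ℝ) + 1) • z i := by
  rw [collect_apply, add_smul, one_smul, Nat.cast_smul_eq_nsmul, add_comm]
  exact congrArg (· + z i) (Finset.sum_const (z i))

theorem average_eq (y : D.Var) (i : Fin M) : D.average y i =
    ((Fintype.card {j // i ∈ S.nbr j} : ℝ) + 1)⁻¹ • D.collect (D.augMap y) i := by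
  rw [collect_apply]
  rfl

theorem continuous_average : Continuous D.average := by
  unfold average LocVar.own LocVar.copy
  fun_prop

/-- Averaging is the orthogonal projection onto consensus. -/
theorem augForm_sub_average (y : D.Var) {w : ∀ i, D.Aug i} (hw : w ∈ D.consensus) :
    D.augForm (D.augMap y - D.augOfMap (D.average y)) w = 0 := by
  obtain ⟨w, rfl⟩ := hw
  have hcollect (i : Fin M) : D.collect (D.augMap y - D.augOfMap (D.average y)) i = 0 := by
    rw [map_sub, Pi.sub_apply, collect_augOfMap, average_eq, smul_inv_smul₀ (by positivity),
      sub_self]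
  simp only [augForm_augOfMap, hcollect, Pi.zero_apply, zero_dotProduct, Finset.sum_const_zero]

variable {D}

theorem augMap_mem_consensus_iff {y : D.Var} : D.augMap y ∈ D.consensus ↔ D.Consistent y := by
  constructor
  · rintro ⟨z, hz⟩ i j
    have hcopy : z j = LocVar.copy (y i) j := congrFun (congrArg Prod.snd (congrFun hz i)) j
    have hown : z j = LocVar.own (y j) := congrArg Prod.fst (congrFun hz j)
    exact hcopy.symm.trans hown
  · exact fun h => ⟨fun i => LocVar.own (y i),
      funext fun i => Prod.ext rfl (funext fun j => (h i j).symm)⟩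

theorem Consistent.copy_eq {y : D.Var} (h : D.Consistent y) (i : Fin M) (k : Fin (D.N + 1)) :
    (fun j : S.nbr i => LocVar.copy (y i) j k) = S.nbrState (fun i => LocVar.own (y i) k) i :=
  funext fun j => congrFun (h i j) k

/-- The MPC problem at the state `x` for the switching sequence `s` as a consensus problem. -/
def consensusProblem (hcost : D.CostAssumption) (x : S.State) (s : ∀ i, D.SwSeq i) :
    ConsensusProblem D.Var (∀ i, D.Aug i) where
  B := D.totalForm
  isPosSemidef_B := hcost.isPosSemidef_totalForm
  G := D.augForm
  isSymm_G := D.isSymm_augForm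
  pos_G := D.augForm_self_pos
  T := D.augMap
  C := {y | ∀ i, y i ∈ D.localSet i (x i) ∩ D.switchSet i (s i)}
  L := D.consensus
  ρ := D.ρ
  ρ_pos := D.ρ_pos

variable {hcost : D.CostAssumption} {x : S.State} {s : ∀ i, D.SwSeq i}

theorem augLagrangian_consensusProblem (lam : ∀ i, D.Aug i) (z : ∀ i, D.Traj i) (y : D.Var) :
    (D.consensusProblem hcost x s).augLagrangian lam (D.augOfMap z) y
      = ∑ i, D.localObj i (lam i) z (y i) := by
  simp only [localObj, Finset.sum_add_distrib, ← Finset.mul_sum, ← totalForm_self]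
  simp only [ConsensusProblem.augLagrangian, consensusProblem, augForm_apply]
  rfl

theorem consensusProblem_inter_preimage : (D.consensusProblem hcost x s).C ∩
    (D.consensusProblem hcost x s).T ⁻¹' (D.consensusProblem hcost x s).L = D.feasibleSw s x :=
  Set.ext fun _ => and_congr_right fun _ => augMap_mem_consensus_iff

theorem isDefinite_consensusProblem : (D.consensusProblem hcost x s).IsDefinite := by
  intro y hy hzero
  have hcons : D.Consistent y := augMap_mem_consensus_iff.1 hy
  have hcosts : ∑ i, D.cost i (y i) = 0 := (D.totalForm_self y).symm.trans hzero
  rw [Finset.sum_eq_zero_iff_of_nonneg fun i _ => hcost.cost_nonneg i _] at hcosts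
  have hvanish := fun i => hcost.eq_zero_of_cost_eq_zero (hcosts i (Finset.mem_univ i))
  exact funext fun i => Prod.ext (Prod.ext (hvanish i).1 (funext fun j =>
    (hcons i j).trans (hvanish j).1)) (hvanish i).2

theorem isMinOn_augLagrangian_consensusProblem_iff {lam : ∀ i, D.Aug i} {z : ∀ i, D.Traj i}
    {y : D.Var} (hy : y ∈ (D.consensusProblem hcost x s).C) :
    IsMinOn ((D.consensusProblem hcost x s).augLagrangian lam (D.augOfMap z))
      (D.consensusProblem hcost x s).C y ↔
    ∀ i, IsMinOn (D.localObj i (lam i) z) (D.localSet i (x i) ∩ D.switchSet i (s i)) (y i) := by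
  rw [← isMinOn_sum_iff hy]
  exact iff_of_eq (congrArg (IsMinOn · _ y) (funext (augLagrangian_consensusProblem lam z)))

theorem CouplingAssumption.nonempty_feasibleSw (hcoupling : D.CouplingAssumption) (hx : x ∈ D.X0)
    (h : ∀ i, (D.localSet i (x i) ∩ D.switchSet i (s i)).Nonempty) :
    (D.feasibleSw s x).Nonempty := by
  by_contra hne
  exact hcoupling x hx ⟨s, Set.not_nonempty_iff_eq_empty.1 hne, h⟩

end MPCDesign

end

/-! ### Limits of switching ADMM -/

theorem IsPolyhedron.isClosed {n : ℕ} {T : Set (Fin n → ℝ)} (h : IsPolyhedron T) : IsClosed T :=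
  h.isPolyhedral.isClosed

theorem PWANetwork.isClosed_X {M : ℕ} (S : PWANetwork M) (i : Fin M) : IsClosed (S.X i) := by
  rw [← S.iUnion_P i]
  exact isClosed_iUnion_of_finite fun l => (S.isPolyhedron_P i l).isClosed

theorem PWANetwork.aff_eq_f {M : ℕ} (S : PWANetwork M) {i : Fin M} {l : Fin (S.L i)} {x : S.St i}
    (hx : x ∈ S.P i l) (u : S.Inp i) (xn : ∀ j : S.nbr i, S.St j) :
    S.aff i l x u xn = S.f i x u xn :=
  (S.f_eq i l x u xn hx).symm

noncomputable section

namespace MPCDesign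

variable {M : ℕ} {S : PWANetwork M} {D : MPCDesign S}

theorem isClosed_localSet {i : Fin M} (hXT : IsClosed (D.XT i)) (xi : S.St i) :
    IsClosed (D.localSet i xi) := by
  simp only [localSet, LocVar.own, LocVar.inp, LocVar.copy, PWANetwork.h, Set.ofPred_and,
    Set.ofPred_forall]
  refine (isClosed_iInter fun k => ?_).inter <| (isClosed_iInter fun k => ?_).inter <|
    (isClosed_iInter fun k => ?_).inter <| IsClosed.inter ?_ ?_
  · exact isClosed_le (by fun_prop) continuous_const
  · exact (S.isClosed_X i).preimage (by fun_prop : Continuous fun y : D.LocVar i => y.1.1 k)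
  · exact (S.isClosed_U i).preimage (by fun_prop : Continuous fun y : D.LocVar i => y.2 k)
  · exact isClosed_eq (by fun_prop) continuous_const
  · exact hXT.preimage (by fun_prop : Continuous fun y : D.LocVar i => y.1.1 (Fin.last _))

theorem isClosed_switchSet (i : Fin M) (s : D.SwSeq i) : IsClosed (D.switchSet i s) := by
  simp only [switchSet, LocVar.own, LocVar.inp, LocVar.copy, PWANetwork.aff, Set.ofPred_and,
    Set.ofPred_forall]
  refine (isClosed_iInter fun k => ?_).inter (isClosed_iInter fun k => ?_)
  · exact isClosed_eq (by fun_prop) (by fun_prop)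
  · exact (S.isPolyhedron_P i _).isClosed.preimage
      (by fun_prop : Continuous fun y : D.LocVar i => y.1.1 k)

theorem isClosed_consensusProblem_C (hXT : ∀ i, IsClosed (D.XT i)) (hcost : D.CostAssumption)
    (x : S.State) (s : ∀ i, D.SwSeq i) : IsClosed (D.consensusProblem hcost x s).C := by
  simp only [consensusProblem, Set.ofPred_forall]
  exact isClosed_iInter fun i => ((isClosed_localSet (hXT i) (x i)).inter
    (isClosed_switchSet i (s i))).preimage (continuous_apply i)

theorem feasibleSw_subset (s : ∀ i, D.SwSeq i) (x : S.State) : D.feasibleSw s x ⊆ D.feasible x :=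
  fun _ hy => ⟨fun i => (hy.1 i).1, fun i k =>
    ((hy.1 i).2.1 k).trans (S.aff_eq_f ((hy.1 i).2.2 _) _ _), hy.2⟩

namespace IsSwADMM

variable {x : S.State} {u : ∀ i, D.InpSeq i} {s : ℕ → ∀ i, D.SwSeq i} {y : ℕ → D.Var}
  {z : ℕ → ∀ i, D.Traj i} {lam : ℕ → ∀ i, D.Aug i}

theorem lam_succ_eq (h : D.IsSwADMM x u s y z lam) (τ : ℕ) :
    lam (τ + 1) = lam τ + D.ρ • (D.augMap (y τ) - D.augOfMap (z (τ + 1))) :=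
  funext fun i => h.lam_succ τ i

theorem z_succ_eq (h : D.IsSwADMM x u s y z lam) (τ : ℕ) : z (τ + 1) = D.average (y τ) :=
  funext fun i => h.z_succ τ i

theorem augForm_lam (h : D.IsSwADMM x u s y z lam) (τ : ℕ) {w : ∀ i, D.Aug i}
    (hw : w ∈ D.consensus) : D.augForm (lam τ) w = 0 := by
  induction τ with
  | zero => rw [h.lam_zero, map_zero, LinearMap.zero_apply]
  | succ τ ih =>
    rw [h.lam_succ_eq, map_add, LinearMap.add_apply, ih, map_smul, LinearMap.smul_apply,
      h.z_succ_eq, D.augForm_sub_average _ hw, smul_zero, add_zero]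

theorem switch_eq (h : D.IsSwADMM x u s y z lam) (τ : ℕ) : s (D.Tcut + τ) = s D.Tcut := by
  induction τ with
  | zero => rfl
  | succ τ ih => rw [← add_assoc, h.s_frozen _ (Nat.le_add_right _ _), ih]

theorem y_mem_consensusProblem (h : D.IsSwADMM x u s y z lam) (hcost : D.CostAssumption) (τ : ℕ) :
    y (D.Tcut + τ) ∈ (D.consensusProblem hcost x (s D.Tcut)).C := fun i => by
  simpa only [h.switch_eq] using h.y_mem (D.Tcut + τ) i

theorem isADMM (h : D.IsSwADMM x u s y z lam) (hcost : D.CostAssumption) :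
    (D.consensusProblem hcost x (s D.Tcut)).IsADMM (fun τ => y (D.Tcut + τ))
      (fun τ => D.augOfMap (z (D.Tcut + τ))) fun τ => lam (D.Tcut + τ) where
  y_mem := h.y_mem_consensusProblem hcost
  y_min τ := (isMinOn_augLagrangian_consensusProblem_iff (h.y_mem_consensusProblem hcost τ)).2
    fun i => by simpa only [h.switch_eq] using h.y_min (D.Tcut + τ) i
  z_mem _ := ⟨_, rfl⟩
  lam_orthogonal τ _ hw := h.augForm_lam (D.Tcut + τ) hw
  lam_succ τ := h.lam_succ_eq (D.Tcut + τ)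

theorem nonempty_feasibleSw (h : D.IsSwADMM x u s y z lam) (hcoupling : D.CouplingAssumption)
    (hx : x ∈ D.X0) (τ : ℕ) : (D.feasibleSw (s τ) x).Nonempty :=
  hcoupling.nonempty_feasibleSw hx fun i => ⟨y τ i, h.y_mem τ i⟩

theorem limit_mem (h : D.IsSwADMM x u s y z lam) (hcoupling : D.CouplingAssumption)
    (hXT : ∀ i, IsClosed (D.XT i)) (hcost : D.CostAssumption) (hx : x ∈ D.X0) {y' : D.Var}
    (hlim : Tendsto y atTop (𝓝 y')) : y' ∈ D.feasibleSw (s D.Tcut) x := by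
  have hshift : Tendsto (fun τ => D.Tcut + τ) atTop atTop :=
    tendsto_atTop_mono (fun τ => Nat.le_add_left τ D.Tcut) tendsto_id
  have hz : Tendsto z atTop (𝓝 (D.average y')) := by
    rw [← tendsto_add_atTop_iff_nat 1]
    exact ((D.continuous_average.tendsto y').comp hlim).congr fun τ => (h.z_succ_eq τ).symm
  have hconsensus := (h.isADMM hcost).map_limit_eq (hlim.comp hshift)
    ((D.augOfMap.continuous_of_finiteDimensional.tendsto _).comp (hz.comp hshift))
    (consensusProblem_inter_preimage.symm ▸ h.nonempty_feasibleSw hcoupling hx D.Tcut)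
  exact ⟨(isClosed_consensusProblem_C hXT hcost x _).mem_of_tendsto (hlim.comp hshift)
    (Eventually.of_forall (h.y_mem_consensusProblem hcost)),
    augMap_mem_consensus_iff.1 ⟨D.average y', hconsensus.symm⟩⟩

end IsSwADMM

namespace IsPlan

variable {x : S.State} {u : ∀ i, D.InpSeq i} {y : D.Var}

theorem mem_feasible (h : D.IsPlan x u y) (hcoupling : D.CouplingAssumption)
    (hXT : ∀ i, IsClosed (D.XT i)) (hcost : D.CostAssumption) (hx : x ∈ D.X0) :
    y ∈ D.feasible x := by
  obtain ⟨y', ⟨s, ys, z, lam, hrun, hlim⟩, rfl⟩ := h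
  split_ifs with hrollout
  · exact hrollout.1
  · exact feasibleSw_subset _ _ (hrun.limit_mem hcoupling hXT hcost hx hlim)

theorem cost_le_rollout (h : D.IsPlan x u y) (hu : D.rollout x u ∈ D.feasible x) (i : Fin M) :
    D.cost i (y i) ≤ D.cost i (D.rollout x u i) := by
  obtain ⟨y', -, rfl⟩ := h
  split_ifs with hrollout
  · exact le_rfl
  · exact of_not_not (fun hlt => hrollout ⟨hu, hlt⟩) i

end IsPlan

end MPCDesign

end

/-! ### Roll-outs and recursive feasibility -/

/-- The states that satisfy the coupled constraints and the state constraints. -/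
def PWANetwork.admissible {M : ℕ} (S : PWANetwork M) : Set S.State :=
  {x | (∀ i, S.h i (x i) (S.nbrState x i) ≤ 0) ∧ ∀ i, x i ∈ S.X i}

noncomputable section

namespace MPCDesign

variable {M : ℕ} {S : PWANetwork M}

section Rollout

variable (D : MPCDesign S)

/-- The global input at stage `k` of the input sequences `u`, zero from the horizon on. -/
def inputAt (u : ∀ i, D.InpSeq i) (k : ℕ) : S.Input :=
  fun i => if hk : k < D.N then u i ⟨k, hk⟩ else 0

/-- The cost of the roll-out of `u` from `x`, as a function of the global states and inputs. -/
def rollCost (x : S.State) (u : ∀ i, D.InpSeq i) : ℝ :=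
  ∑ k ∈ Finset.range D.N, D.totalStage (D.roll x u k) (D.inputAt u k)
    + D.totalVf (D.roll x u D.N)

/-- `w` is a global input that the terminal controllers may apply at the state `x`. -/
def IsTerminalInput (x : S.State) (w : S.Input) : Prop :=
  ∃ l : ∀ i, Fin (S.L i), (∀ i, x i ∈ S.P i (l i)) ∧ w = fun i => D.K i (l i) *ᵥ x i

end Rollout

variable {D : MPCDesign S} {x : S.State} {u : ∀ i, D.InpSeq i}

theorem inputAt_of_lt {k : ℕ} (hk : k < D.N) : D.inputAt u k = fun i => u i ⟨k, hk⟩ :=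
  funext fun _ => dif_pos hk

theorem sum_cost_rollout : ∑ i, D.cost i (D.rollout x u i) = D.rollCost x u := by
  rw [rollCost, ← Fin.sum_univ_eq_sum_range fun k => D.totalStage (D.roll x u k) (D.inputAt u k)]
  simp only [cost, Finset.sum_add_distrib, totalVf, totalStage]
  rw [Finset.sum_comm]
  simp only [inputAt_of_lt (Fin.is_lt _)]
  rfl

theorem rollout_dynamics (i : Fin M) (k : Fin D.N) :
    LocVar.own (D.rollout x u i) k.succ = S.f i (LocVar.own (D.rollout x u i) k.castSucc)
      (LocVar.inp (D.rollout x u i) k) (fun j => LocVar.copy (D.rollout x u i) j k.castSucc) :=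
  congrArg (S.f i _ · _) (congrFun (inputAt_of_lt k.2) i)

theorem rollout_mem_feasible_iff : D.rollout x u ∈ D.feasible x ↔
    (∀ k ≤ D.N, D.roll x u k ∈ S.admissible) ∧ (∀ i k, u i k ∈ S.U i) ∧
      D.roll x u D.N ∈ D.XTglobal := by
  constructor
  · rintro ⟨hlocal, -⟩
    exact ⟨fun k hk => ⟨fun i => (hlocal i).1 ⟨k, Nat.lt_succ_of_le hk⟩,
      fun i => (hlocal i).2.1 ⟨k, Nat.lt_succ_of_le hk⟩⟩, fun i => (hlocal i).2.2.1,
      fun i => (hlocal i).2.2.2.2⟩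
  · rintro ⟨hadm, hU, hXT⟩
    exact ⟨fun i => ⟨fun k => (hadm k k.is_le).1 i, fun k => (hadm k k.is_le).2 i, hU i, rfl,
      hXT i⟩, rollout_dynamics, fun _ _ => rfl⟩

theorem mem_admissible_of_mem_X0 (hx : x ∈ D.X0) : x ∈ S.admissible := by
  obtain ⟨y, hy⟩ := hx
  have hzero : (fun i => LocVar.own (y i) 0) = x := funext fun i => (hy.1 i).2.2.2.1
  rw [← hzero]
  exact ⟨fun i => hy.2.2.copy_eq i 0 ▸ (hy.1 i).1 0, fun i => (hy.1 i).2.1 0⟩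

theorem eq_rollout_of_mem_feasible {y : D.Var} (hy : y ∈ D.feasible x) :
    y = D.rollout x fun i => LocVar.inp (y i) := by
  have hroll : ∀ k : Fin (D.N + 1), (fun i => LocVar.own (y i) k)
      = D.roll x (fun i => LocVar.inp (y i)) k := by
    intro k
    induction k using Fin.induction with
    | zero => exact funext fun i => (hy.1 i).2.2.2.1
    | succ k ih =>
      funext i
      rw [hy.2.1 i k, hy.2.2.copy_eq, ih, show LocVar.own (y i) k.castSucc = _ from congrFun ih i]
      exact (rollout_dynamics (x := x) (u := fun i => LocVar.inp (y i)) i k).symm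
  have hown : ∀ i, LocVar.own (y i) = fun k : Fin (D.N + 1) => D.roll x _ k i :=
    fun i => funext fun k => congrFun (hroll k) i
  exact funext fun i =>
    Prod.ext (Prod.ext (hown i) (funext fun j => (hy.2.2 i j).trans (hown j))) rfl

theorem CostAssumption.exists_mul_sq_norm_roll_le (hcost : D.CostAssumption) :
    ∃ a > 0, ∀ x u, ∀ k ≤ D.N, a * ‖D.roll x u k‖ ^ 2 ≤ D.rollCost x u := by
  obtain ⟨a, ha, hstage⟩ := hcost.exists_mul_sq_norm_le_totalStage
  obtain ⟨b, hb, hVf⟩ := exists_mul_sq_norm_le_sum_dotProduct hcost.posDef_Φ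
  have hstage₀ (x u) : 0 ≤ D.totalStage x u := le_trans (by positivity) (hstage x u)
  have hVf₀ (x) : 0 ≤ D.totalVf x := le_trans (by positivity) (hVf x)
  refine ⟨min a b, lt_min ha hb, fun x u k hk => ?_⟩
  rcases hk.lt_or_eq with hk | rfl
  · calc min a b * ‖D.roll x u k‖ ^ 2 ≤ a * ‖D.roll x u k‖ ^ 2 := by gcongr; exact min_le_left _ _
      _ ≤ D.totalStage (D.roll x u k) (D.inputAt u k) := hstage _ _
      _ ≤ ∑ k ∈ Finset.range D.N, D.totalStage (D.roll x u k) (D.inputAt u k) :=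
        Finset.single_le_sum (f := fun k => D.totalStage (D.roll x u k) (D.inputAt u k))
          (fun _ _ => hstage₀ _ _) (Finset.mem_range.2 hk)
      _ ≤ D.rollCost x u := le_add_of_nonneg_right (hVf₀ _)
  · calc min a b * ‖D.roll x u D.N‖ ^ 2 ≤ b * ‖D.roll x u D.N‖ ^ 2 := by
          gcongr; exact min_le_right _ _
      _ ≤ D.totalVf (D.roll x u D.N) := hVf _
      _ ≤ D.rollCost x u := le_add_of_nonneg_left (Finset.sum_nonneg fun _ _ => hstage₀ _ _)

namespace TerminalAssumption

variable (hterminal : D.TerminalAssumption)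

include hterminal

theorem subset_X (i : Fin M) : D.XT i ⊆ S.X i := by
  intro x hx
  obtain ⟨l, -, hl⟩ := Set.mem_iUnion₂.1 (hterminal.subset i hx)
  exact S.iUnion_P i ▸ Set.mem_iUnion.2 ⟨l, hl⟩

theorem next_mem (hx : x ∈ D.XTglobal) {w : S.Input} (hw : D.IsTerminalInput x w) :
    S.next x w ∈ D.XTglobal := by
  obtain ⟨l, hl, rfl⟩ := hw
  exact fun i => hterminal.invariant i _ (hx i) _ (hl i) _ fun j => hx j

theorem next_mem_admissible (hx : x ∈ D.XTglobal) (hadm : x ∈ S.admissible) {w : S.Input}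
    (hw : D.IsTerminalInput x w) : S.next x w ∈ S.admissible := by
  refine ⟨?_, fun i => hterminal.subset_X i (hterminal.next_mem hx hw i)⟩
  obtain ⟨l, hl, rfl⟩ := hw
  exact hterminal.coupled x hx hadm.1 l hl

theorem terminalInput_mem (hx : x ∈ D.XTglobal) {w : S.Input} (hw : D.IsTerminalInput x w)
    (i : Fin M) : w i ∈ S.U i := by
  obtain ⟨l, hl, rfl⟩ := hw
  exact hterminal.input_mem i _ (hx i) _ (hl i)

end TerminalAssumption

theorem CostAssumption.totalVf_next_le (hcost : D.CostAssumption) (hx : x ∈ D.XTglobal)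
    {w : S.Input} (hw : D.IsTerminalInput x w) :
    D.totalVf (S.next x w) + D.totalStage x w ≤ D.totalVf x := by
  obtain ⟨l, hl, rfl⟩ := hw
  have hdecrease := hcost.decrease x hx l hl
  rw [Finset.sum_add_distrib, Finset.sum_sub_distrib] at hdecrease
  unfold totalVf totalStage PWANetwork.next
  linarith

theorem exists_isTerminalInput (hx : ∀ i, x i ∈ S.X i) : ∃ w, D.IsTerminalInput x w := by
  simp only [← S.iUnion_P, Set.mem_iUnion] at hx
  choose l hl using hx
  exact ⟨_, l, hl, rfl⟩

section Shift

variable {v : ∀ i, D.InpSeq i}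

theorem exists_isShiftedGuess (hx : D.roll x u D.N ∈ S.admissible) :
    ∃ v, D.IsShiftedGuess (D.rollout x u) v := by
  obtain ⟨-, l, hl, -⟩ := D.exists_isTerminalInput hx.2
  exact ⟨_, fun i => ⟨l i, hl i, rfl⟩⟩

namespace IsShiftedGuess

theorem exists_terminalInput (hv : D.IsShiftedGuess (D.rollout x u) v) :
    ∃ w, D.IsTerminalInput (D.roll x u D.N) w ∧
      (∀ k, k + 1 < D.N → D.inputAt v k = D.inputAt u (k + 1)) ∧
      ∀ k, k + 1 = D.N → D.inputAt v k = w := by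
  choose l hl hvl using hv
  refine ⟨_, ⟨l, hl, rfl⟩, fun k hk => funext fun i => ?_, fun k hk => funext fun i => ?_⟩
  · simp only [inputAt_of_lt hk, inputAt_of_lt (k.lt_succ_self.trans hk), hvl i]
    exact dif_pos hk
  · simp only [inputAt_of_lt (show k < D.N by lia), hvl i]
    exact dif_neg hk.not_lt

theorem roll_eq (hv : D.IsShiftedGuess (D.rollout x u) v) {k : ℕ} (hk : k < D.N) :
    D.roll (S.next x (D.inputAt u 0)) v k = D.roll x u (k + 1) := by
  obtain ⟨-, -, hinput, -⟩ := hv.exists_terminalInput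
  induction k with
  | zero => rfl
  | succ k ih =>
    exact congrArg₂ S.next (ih (k.lt_succ_self.trans hk)) (hinput k hk)

theorem roll_last_eq (hv : D.IsShiftedGuess (D.rollout x u) v) {w : S.Input}
    (hw : ∀ k, k + 1 = D.N → D.inputAt v k = w) :
    D.roll (S.next x (D.inputAt u 0)) v D.N = S.next (D.roll x u D.N) w := by
  obtain ⟨n, hn⟩ := Nat.exists_eq_add_one_of_ne_zero D.N_pos.ne'
  have hlast : D.roll (S.next x (D.inputAt u 0)) v (n + 1) = S.next (D.roll x u (n + 1)) w :=
    congrArg₂ S.next (hv.roll_eq (by lia)) (hw n hn.symm)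
  rwa [← hn] at hlast

theorem rollout_mem_feasible (hv : D.IsShiftedGuess (D.rollout x u) v)
    (hterminal : D.TerminalAssumption) (hu : D.rollout x u ∈ D.feasible x) :
    D.rollout (S.next x (D.inputAt u 0)) v ∈ D.feasible (S.next x (D.inputAt u 0)) := by
  obtain ⟨w, hterm, hinput, hlast⟩ := hv.exists_terminalInput
  obtain ⟨hadm, hU, hXT⟩ := rollout_mem_feasible_iff.1 hu
  have hroll := hv.roll_last_eq hlast
  refine rollout_mem_feasible_iff.2 ⟨fun k hk => ?_, fun i k => ?_, ?_⟩
  · rcases hk.lt_or_eq with hk | rfl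
    · rw [hv.roll_eq hk]
      exact hadm _ hk
    · rw [hroll]
      exact hterminal.next_mem_admissible hXT (hadm _ le_rfl) hterm
  · have hvk : D.inputAt v k i = v i k := congrFun (inputAt_of_lt k.2) i
    rw [← hvk]
    rcases (Nat.succ_le_of_lt k.2).lt_or_eq with hk | hk
    · rw [hinput k hk, inputAt_of_lt hk]
      exact hU i _
    · rw [hlast k hk]
      exact hterminal.terminalInput_mem hXT hterm i
  · rw [hroll]
    exact hterminal.next_mem hXT hterm

theorem rollCost_add_totalStage_le (hv : D.IsShiftedGuess (D.rollout x u) v)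
    (hcost : D.CostAssumption) (hXT : D.roll x u D.N ∈ D.XTglobal) :
    D.rollCost (S.next x (D.inputAt u 0)) v + D.totalStage x (D.inputAt u 0)
      ≤ D.rollCost x u := by
  obtain ⟨w, hterm, hinput, hlast⟩ := hv.exists_terminalInput
  obtain ⟨n, hn⟩ := Nat.exists_eq_add_one_of_ne_zero D.N_pos.ne'
  set x' := S.next x (D.inputAt u 0)
  have hstages : ∑ k ∈ Finset.range n, D.totalStage (D.roll x' v k) (D.inputAt v k)
      = ∑ k ∈ Finset.range n, D.totalStage (D.roll x u (k + 1)) (D.inputAt u (k + 1)) :=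
    Finset.sum_congr rfl fun k hk => by
      have hk : k < n := Finset.mem_range.1 hk
      rw [hv.roll_eq (by lia), hinput k (by lia)]
  have hdecrease := hcost.totalVf_next_le hXT hterm
  have hlaststage : D.totalStage (D.roll x' v n) (D.inputAt v n)
      = D.totalStage (D.roll x u D.N) w := by
    rw [hv.roll_eq (by lia), hlast n hn.symm, hn]
  have hnew : D.rollCost x' v = ∑ k ∈ Finset.range n, D.totalStage (D.roll x' v k) (D.inputAt v k)
      + D.totalStage (D.roll x' v n) (D.inputAt v n) + D.totalVf (D.roll x' v D.N) := by
    rw [rollCost, ← Finset.sum_range_succ, hn]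
  have hold : D.rollCost x u
      = ∑ k ∈ Finset.range n, D.totalStage (D.roll x u (k + 1)) (D.inputAt u (k + 1))
        + D.totalStage x (D.inputAt u 0) + D.totalVf (D.roll x u D.N) := by
    rw [rollCost, hn, Finset.sum_range_succ']
    rfl
  rw [hnew, hold, hstages, hlaststage, hv.roll_last_eq hlast]
  linarith

end IsShiftedGuess

end Shift

end MPCDesign

end

/-! ### The closed loop -/

noncomputable section

namespace MPCDesign

variable {M : ℕ} {S : PWANetwork M}

/-- The loop state reached from `x` by executing the plan that consists of the input sequences `u`
and their roll-out. -/
def planState (D : MPCDesign S) (x : S.State) (u : ∀ i, D.InpSeq i) : D.LoopState :=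
  (S.next x (D.inputAt u 0), some (D.rollout x u))

variable {D : MPCDesign S} {x x0 : S.State} {u u0 u₁ : ∀ i, D.InpSeq i} {σ σ' : D.LoopState}

theorem Step.exists_terminalInput (h : D.Step u0 σ σ') (hσ : σ.1 ∈ D.XTglobal) :
    ∃ w, D.IsTerminalInput σ.1 w ∧ σ'.1 = S.next σ.1 w := by
  obtain ⟨-, -, l, hl, hnext⟩ := h.resolve_right fun hmpc => hmpc.1 hσ
  exact ⟨_, ⟨l, hl, rfl⟩, hnext⟩

theorem Step.exists_planState (h : D.Step u0 σ σ') (hcoupling : D.CouplingAssumption)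
    (hXT : ∀ i, IsClosed (D.XT i)) (hcost : D.CostAssumption) (hσ : σ.1 ∉ D.XTglobal)
    (hσ0 : σ.1 ∈ D.X0) :
    ∃ v u, D.IsGuess u0 σ.2 v ∧ D.rollout σ.1 u ∈ D.feasible σ.1 ∧ σ' = D.planState σ.1 u ∧
      (D.rollout σ.1 v ∈ D.feasible σ.1 → D.rollCost σ.1 u ≤ D.rollCost σ.1 v) := by
  obtain ⟨-, v, y, hguess, hplan, hmem, hnext⟩ := h.resolve_left fun hterm => hσ hterm.1
  have hy := hplan.mem_feasible hcoupling hXT hcost hσ0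
  have hyroll := eq_rollout_of_mem_feasible hy
  refine ⟨v, _, hguess, hyroll ▸ hy, Prod.ext ?_ (hmem.trans (congrArg some hyroll)),
    fun hv => ?_⟩
  · exact hnext.trans (congrArg (S.next σ.1) (inputAt_of_lt D.N_pos).symm)
  · rw [← sum_cost_rollout, ← sum_cost_rollout, ← hyroll]
    exact Finset.sum_le_sum fun i _ => hplan.cost_le_rollout hv i

theorem TerminalAssumption.next_mem_X0 (hterminal : D.TerminalAssumption)
    (hu : D.rollout x u ∈ D.feasible x) : S.next x (D.inputAt u 0) ∈ D.X0 := by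
  obtain ⟨v, hv⟩ := exists_isShiftedGuess ((rollout_mem_feasible_iff.1 hu).1 D.N le_rfl)
  exact ⟨_, hv.rollout_mem_feasible hterminal hu⟩

theorem TerminalAssumption.exists_forall_norm_lt_mem (hterminal : D.TerminalAssumption) :
    ∃ δ > 0, ∀ x : S.State, (∀ i, x i ∈ S.X i) → ‖x‖ < δ → x ∈ D.XTglobal := by
  have hball (i : Fin M) : ∀ᶠ ε in 𝓝[>] (0 : ℝ), Metric.ball 0 ε ∩ S.X i ⊆ D.XT i := by
    obtain ⟨ε, hε, hsub⟩ := Metric.mem_nhdsWithin_iff.1 (hterminal.mem_nhdsWithin i)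
    filter_upwards [Ioo_mem_nhdsGT hε] with ε' hε'
    exact (Set.inter_subset_inter_left _ (Metric.ball_subset_ball hε'.2.le)).trans hsub
  obtain ⟨δ, hδ, hδ₀⟩ := ((eventually_all.2 hball).and self_mem_nhdsWithin).exists
  exact ⟨δ, hδ₀, fun x hx hxδ i =>
    hδ i ⟨mem_ball_zero_iff.2 ((norm_le_pi_norm x i).trans_lt hxδ), hx i⟩⟩

theorem exists_le_totalStage (hterminal : D.TerminalAssumption) (hcost : D.CostAssumption) :
    ∃ η > 0, ∀ x u, (∀ i, x i ∈ S.X i) → x ∉ D.XTglobal → η ≤ D.totalStage x u := by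
  obtain ⟨a, ha, hstage⟩ := hcost.exists_mul_sq_norm_le_totalStage
  obtain ⟨δ, hδ, hball⟩ := hterminal.exists_forall_norm_lt_mem
  refine ⟨a * δ ^ 2, by positivity, fun x u hx hxT => le_trans ?_ (hstage x u)⟩
  gcongr
  exact not_lt.1 (mt (hball x hx) hxT)

/-- On the terminal set the terminal cost is a Lyapunov function. -/
theorem exists_terminal_decay (hterminal : D.TerminalAssumption) (hcost : D.CostAssumption) :
    ∃ γ : ℝ, 0 < γ ∧ γ < 1 ∧ ∃ C : ℝ, 1 ≤ C ∧ ∀ u0 (σ : ℕ → D.LoopState),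
      (∀ t, D.Step u0 (σ t) (σ (t + 1))) → (σ 0).1 ∈ D.XTglobal →
        ∀ t, ‖(σ t).1‖ ≤ C * γ ^ t * ‖(σ 0).1‖ := by
  obtain ⟨a, ha, hstage⟩ := hcost.exists_mul_sq_norm_le_totalStage
  obtain ⟨a', ha', hlower⟩ := exists_mul_sq_norm_le_sum_dotProduct hcost.posDef_Φ
  obtain ⟨b, hupper⟩ := D.exists_totalVf_le_mul_sq_norm
  obtain ⟨γ, hγ₀, hγ₁, C, hC, hdecay⟩ := exists_norm_le_of_lyapunov_decrease ha ha' hlower hupper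
  refine ⟨γ, hγ₀, hγ₁, C, hC, fun u0 σ hσ h0 => hdecay (fun t => (σ t).1) ?_⟩
  have hmem (t : ℕ) : (σ t).1 ∈ D.XTglobal := by
    induction t with
    | zero => exact h0
    | succ t ih =>
      obtain ⟨w, hw, hnext⟩ := (hσ t).exists_terminalInput ih
      exact hnext ▸ hterminal.next_mem ih hw
  intro t
  obtain ⟨w, hw, hnext⟩ := (hσ t).exists_terminalInput (hmem t)
  rw [hnext]
  exact (add_le_add_right (hstage _ w) _).trans (hcost.totalVf_next_le (hmem t) hw)

namespace IsClosedLoop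

variable {σ : ℕ → D.LoopState}

theorem exists_plan_rollCost_le (hσ : D.IsClosedLoop x0 u0 σ) (hcoupling : D.CouplingAssumption)
    (hterminal : D.TerminalAssumption) (hcost : D.CostAssumption) {η : ℝ}
    (hη : ∀ x u, (∀ i, x i ∈ S.X i) → x ∉ D.XTglobal → η ≤ D.totalStage x u)
    (hu₁ : D.rollout x0 u₁ ∈ D.feasible x0) (hσ₁ : σ 1 = D.planState x0 u₁) (t : ℕ)
    (ht : ∀ k ≤ t, (σ k).1 ∉ D.XTglobal) :
    ∃ u, D.rollout (σ t).1 u ∈ D.feasible (σ t).1 ∧ σ (t + 1) = D.planState (σ t).1 u ∧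
      D.rollCost (σ t).1 u ≤ D.rollCost x0 u₁ - t * η := by
  induction t with
  | zero =>
    refine ⟨u₁, ?_, ?_, ?_⟩ <;> simp [hσ.1, hu₁, hσ₁]
  | succ t ih =>
    obtain ⟨u, hu, hplan, hle⟩ := ih fun k hk => ht k (hk.trans t.le_succ)
    have hx' : (σ (t + 1)).1 = S.next (σ t).1 (D.inputAt u 0) := congrArg Prod.fst hplan
    obtain ⟨v, u', hguess, hu', hplan', hle'⟩ := (hσ.2 (t + 1)).exists_planState hcoupling
      hterminal.isClosed hcost (ht _ le_rfl) (hx' ▸ hterminal.next_mem_X0 hu)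
    have hshift : D.IsShiftedGuess (D.rollout (σ t).1 u) v := by
      rw [hplan] at hguess
      exact hguess
    obtain ⟨hadm, -, hXT⟩ := rollout_mem_feasible_iff.1 hu
    have hdecrease := hshift.rollCost_add_totalStage_le hcost hXT
    rw [← hx'] at hdecrease
    have hstage : η ≤ D.totalStage (σ t).1 (D.inputAt u 0) :=
      hη _ _ (hadm 0 D.N.zero_le).2 (ht t t.le_succ)
    have hv := hle' (hx' ▸ hshift.rollout_mem_feasible hterminal hu)
    refine ⟨u', hu', hplan', ?_⟩
    push_cast
    linarith

theorem exists_hitting_time (hσ : D.IsClosedLoop x0 u0 σ) (hcoupling : D.CouplingAssumption)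
    (hterminal : D.TerminalAssumption) (hcost : D.CostAssumption) {η : ℝ} (hη₀ : 0 < η)
    (hη : ∀ x u, (∀ i, x i ∈ S.X i) → x ∉ D.XTglobal → η ≤ D.totalStage x u)
    (hu₁ : D.rollout x0 u₁ ∈ D.feasible x0) (hσ₁ : σ 1 = D.planState x0 u₁) {T₀ : ℕ}
    (hT₀ : D.rollCost x0 u₁ / η < T₀) :
    ∃ T ≤ T₀, (σ T).1 ∈ D.XTglobal ∧ ∀ k < T, (σ k).1 ∉ D.XTglobal := by
  classical
  have hhit : ∃ T, T ≤ T₀ ∧ (σ T).1 ∈ D.XTglobal := by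
    by_contra! houtside
    obtain ⟨u, -, -, hle⟩ :=
      hσ.exists_plan_rollCost_le hcoupling hterminal hcost hη hu₁ hσ₁ T₀ houtside
    have hpos : 0 ≤ D.rollCost (σ T₀).1 u := by
      rw [← sum_cost_rollout]
      exact Finset.sum_nonneg fun i _ => hcost.cost_nonneg i _
    rw [div_lt_iff₀ hη₀] at hT₀
    linarith
  obtain ⟨hle, hmem⟩ := Nat.find_spec hhit
  exact ⟨Nat.find hhit, hle, hmem, fun k hk hkT => Nat.find_min hhit hk ⟨hk.le.trans hle, hkT⟩⟩

theorem norm_le_of_forall_lt_not_mem (hσ : D.IsClosedLoop x0 u0 σ)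
    (hcoupling : D.CouplingAssumption) (hterminal : D.TerminalAssumption)
    (hcost : D.CostAssumption) {a : ℝ} (ha₀ : 0 < a)
    (ha : ∀ x u, ∀ k ≤ D.N, a * ‖D.roll x u k‖ ^ 2 ≤ D.rollCost x u)
    (hu₁ : D.rollout x0 u₁ ∈ D.feasible x0) (hσ₁ : σ 1 = D.planState x0 u₁) {T : ℕ}
    (hT : ∀ k < T, (σ k).1 ∉ D.XTglobal) {t : ℕ} (ht : t ≤ T) :
    ‖(σ t).1‖ ≤ √(D.rollCost x0 u₁ / a) := by
  obtain ⟨η, hη₀, hη⟩ := exists_le_totalStage hterminal hcost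
  suffices hroll : ∃ x u, ∃ k ≤ D.N, (σ t).1 = D.roll x u k ∧
      D.rollCost x u ≤ D.rollCost x0 u₁ by
    obtain ⟨x, u, k, hk, hxk, hle⟩ := hroll
    rw [hxk]
    exact Real.le_sqrt_of_sq_le ((le_div_iff₀' ha₀).2 ((ha x u k hk).trans hle))
  rcases t with _ | t
  · exact ⟨x0, u₁, 0, D.N.zero_le, congrArg Prod.fst hσ.1, le_rfl⟩
  · obtain ⟨u, -, hplan, hle⟩ := hσ.exists_plan_rollCost_le hcoupling hterminal hcost hη hu₁ hσ₁ t
      fun k hk => hT k (hk.trans_lt ht)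
    exact ⟨_, u, 1, D.N_pos, congrArg Prod.fst hplan,
      hle.trans (sub_le_self _ (mul_nonneg t.cast_nonneg hη₀.le))⟩

end IsClosedLoop

/-- The cost of the plans bounds both the states outside the terminal set and, as it drops by a
fixed amount per time step, the time spent there. -/
theorem exists_decay_of_rollCost_le (hcoupling : D.CouplingAssumption)
    (hterminal : D.TerminalAssumption) (hcost : D.CostAssumption) {γ C : ℝ} (hγ₀ : 0 < γ)
    (hγ₁ : γ ≤ 1) (hC : 1 ≤ C)
    (hdecay : ∀ u0 (σ : ℕ → D.LoopState), (∀ t, D.Step u0 (σ t) (σ (t + 1))) →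
      (σ 0).1 ∈ D.XTglobal → ∀ t, ‖(σ t).1‖ ≤ C * γ ^ t * ‖(σ 0).1‖) (J : ℝ) :
    ∃ C' : ℝ, ∀ x0 u0 σ u₁, D.IsClosedLoop x0 u0 σ → x0 ∉ D.XTglobal →
      D.rollout x0 u₁ ∈ D.feasible x0 → σ 1 = D.planState x0 u₁ → D.rollCost x0 u₁ ≤ J →
        ∀ t, ‖(σ t).1‖ ≤ C' * γ ^ t * ‖x0‖ := by
  obtain ⟨a, ha₀, ha⟩ := hcost.exists_mul_sq_norm_roll_le
  obtain ⟨δ, hδ, hball⟩ := hterminal.exists_forall_norm_lt_mem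
  obtain ⟨η, hη₀, hη⟩ := exists_le_totalStage hterminal hcost
  obtain ⟨T₀, hT₀⟩ := exists_nat_gt (J / η)
  refine ⟨C * √(J / a) / (δ * γ ^ T₀), fun x0 u0 σ u₁ hσ hx0 hu₁ hσ₁ hJ t => ?_⟩
  obtain ⟨T, hT, hmem, hbefore⟩ := hσ.exists_hitting_time hcoupling hterminal hcost hη₀ hη hu₁ hσ₁
    (T₀ := T₀) (lt_of_le_of_lt (by gcongr) hT₀)
  have hbound : ∀ t ≤ T, ‖(σ t).1‖ ≤ √(J / a) := fun t ht =>
    (hσ.norm_le_of_forall_lt_not_mem hcoupling hterminal hcost ha₀ ha hu₁ hσ₁ hbefore ht).trans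
      (Real.sqrt_le_sqrt (by gcongr))
  have hfar : δ ≤ ‖x0‖ :=
    not_lt.1 (mt (hball x0 ((rollout_mem_feasible_iff.1 hu₁).1 0 D.N.zero_le).2) hx0)
  have hσ₀ : (σ 0).1 = x0 := congrArg Prod.fst hσ.1
  rw [← hσ₀] at hfar ⊢
  exact norm_le_of_decay_from hγ₀ hγ₁ hC hδ hT hbound
    (hdecay u0 (fun t => σ (T + t)) (fun t => hσ.2 (T + t)) hmem) hfar t

theorem exists_rollCost_le_of_isBounded (hX : ∀ i, Bornology.IsBounded (S.X i))
    (hU : ∀ i, Bornology.IsBounded (S.U i)) :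
    ∃ J : ℝ, ∀ x u, D.rollout x u ∈ D.feasible x → D.rollCost x u ≤ J := by
  have hbdd : Bornology.IsBounded {y : D.Var | ∃ x, y ∈ D.feasible x} := by
    have htraj (i : Fin M) : Bornology.IsBounded (Set.univ.pi fun _ : Fin (D.N + 1) => S.X i) :=
      .pi fun _ => hX i
    refine (Bornology.IsBounded.pi fun i => ((htraj i).prod (.pi fun j : S.nbr i => htraj j)).prod
      (.pi fun _ : Fin D.N => hU i)).subset ?_
    rintro y ⟨x, hy⟩ i -
    refine ⟨⟨fun k _ => (hy.1 i).2.1 k, fun j _ k _ => ?_⟩, fun k _ => (hy.1 i).2.2.1 k⟩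
    have hcopy : LocVar.copy (y i) j k = LocVar.own (y j) k := congrFun (hy.2.2 i j) k
    exact show LocVar.copy (y i) j k ∈ S.X j from hcopy ▸ (hy.1 j).2.1 k
  obtain ⟨J, hJ⟩ := hbdd.isCompact_closure.bddAbove_image D.continuous_totalForm_self.continuousOn
  refine ⟨J, fun x u hu => ?_⟩
  rw [← sum_cost_rollout, ← totalForm_self]
  exact hJ ⟨_, subset_closure ⟨x, hu⟩, rfl⟩

theorem exponentiallyStabilizing (hcoupling : D.CouplingAssumption)
    (hterminal : D.TerminalAssumption) (hcost : D.CostAssumption) :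
    D.ExponentiallyStabilizing := by
  obtain ⟨γ, hγ₀, hγ₁, C, hC, hdecay⟩ := exists_terminal_decay hterminal hcost
  obtain ⟨δ, hδ, hball⟩ := hterminal.exists_forall_norm_lt_mem
  have hinside {x0 u0 σ} (hσ : D.IsClosedLoop x0 u0 σ) (hx0 : x0 ∈ D.XTglobal) (t : ℕ) :
      ‖(σ t).1‖ ≤ C * γ ^ t * ‖x0‖ := by
    have h := hdecay u0 σ hσ.2
    rw [hσ.1] at h
    exact h hx0 t
  have hfirst {x0 u0 σ} (hσ : D.IsClosedLoop x0 u0 σ) (hx0 : x0 ∈ D.X0)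
      (hx0T : x0 ∉ D.XTglobal) : ∃ u, D.rollout x0 u ∈ D.feasible x0 ∧ σ 1 = D.planState x0 u := by
    have hstep := hσ.2 0
    rw [hσ.1] at hstep
    obtain ⟨-, u, -, hu, hplan, -⟩ :=
      hstep.exists_planState hcoupling hterminal.isClosed hcost hx0T hx0
    exact ⟨u, hu, hplan⟩
  have houtside := exists_decay_of_rollCost_le hcoupling hterminal hcost hγ₀ hγ₁.le hC hdecay
  refine ⟨γ, hγ₀, hγ₁, ⟨δ, hδ, C, fun x0 u0 σ hx0 hσ hx0δ =>
    hinside hσ (hball x0 (mem_admissible_of_mem_X0 hx0.1).2 hx0δ)⟩, fun x0 u0 σ hx0 hσ => ?_,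
    fun hX hU => ?_⟩
  · by_cases hx0T : x0 ∈ D.XTglobal
    · exact ⟨C, hinside hσ hx0T⟩
    · obtain ⟨u, hu, hplan⟩ := hfirst hσ hx0.1 hx0T
      obtain ⟨C', hC'⟩ := houtside (D.rollCost x0 u)
      exact ⟨C', hC' x0 u0 σ u hσ hx0T hu hplan le_rfl⟩
  · obtain ⟨J, hJ⟩ := exists_rollCost_le_of_isBounded (D := D) hX hU
    obtain ⟨C', hC'⟩ := houtside J
    refine ⟨max C C', fun x0 u0 σ hx0 hσ t => ?_⟩
    by_cases hx0T : x0 ∈ D.XTglobal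
    · exact (hinside hσ hx0T t).trans (by gcongr; exact le_max_left _ _)
    · obtain ⟨u, hu, hplan⟩ := hfirst hσ hx0.1 hx0T
      exact (hC' x0 u0 σ u hσ hx0T hu hplan (hJ x0 u hu) t).trans
        (by gcongr; exact le_max_right _ _)

end MPCDesign

end

/-! ### Well-posedness -/

noncomputable section

namespace MPCDesign

variable {M : ℕ} {S : PWANetwork M} {D : MPCDesign S}

theorem isPolyhedral_setOf_h_nonpos (i : Fin M) (k : Fin (D.N + 1)) :
    IsPolyhedral {y : D.LocVar i | S.h i (LocVar.own y k) (fun j => LocVar.copy y j k) ≤ 0} := by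
  convert IsPolyhedral.setOf_le (((S.H i).mulVecLin ∘ₗ D.ownMap i k
    + ∑ j, (S.Hc i j).mulVecLin ∘ₗ D.copyMap i j k).toAffineMap
      + AffineMap.const ℝ (D.LocVar i) (S.h0 i)) (AffineMap.const ℝ (D.LocVar i) 0) using 3
  simp only [AffineMap.coe_add, Pi.add_apply, LinearMap.coe_toAffineMap, AffineMap.const_apply,
    LinearMap.add_apply, LinearMap.sum_apply, LinearMap.comp_apply, mulVecLin_apply]
  rfl

theorem isPolyhedral_setOf_own_succ_eq_aff (i : Fin M) (l : Fin (S.L i)) (k : Fin D.N) :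
    IsPolyhedral {y : D.LocVar i | LocVar.own y k.succ = S.aff i l (LocVar.own y k.castSucc)
      (LocVar.inp y k) (fun j => LocVar.copy y j k.castSucc)} := by
  convert IsPolyhedral.setOf_eq (D.ownMap i k.succ).toAffineMap
    (((S.A i l).mulVecLin ∘ₗ D.ownMap i k.castSucc
      + (S.B i l).mulVecLin ∘ₗ D.inpMap i k).toAffineMap
      + AffineMap.const ℝ (D.LocVar i) (S.c i l)
      + (∑ j, (S.Ac i l j).mulVecLin ∘ₗ D.copyMap i j k.castSucc).toAffineMap) using 4
  · rfl
  · simp only [AffineMap.coe_add, Pi.add_apply, LinearMap.coe_toAffineMap, AffineMap.const_apply,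
      LinearMap.add_apply, LinearMap.sum_apply, LinearMap.comp_apply, mulVecLin_apply]
    rfl

theorem isPolyhedral_switchSet (i : Fin M) (s : D.SwSeq i) : IsPolyhedral (D.switchSet i s) :=
  (IsPolyhedral.setOf_forall_mem fun k =>
    isPolyhedral_setOf_own_succ_eq_aff i (s (Fin.castSucc k)) k).inter
  (IsPolyhedral.setOf_forall_mem fun k =>
    (S.isPolyhedron_P i (s k)).isPolyhedral.preimage (D.ownMap i k).toAffineMap)

/-- The state constraint sets need not be polyhedra, but each region is. -/
theorem isPolyhedral_localSet_inter_switchSet {i : Fin M} (hU : IsPolyhedron (S.U i))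
    (hXT : IsPolyhedron (D.XT i)) (xi : S.St i) (s : D.SwSeq i) :
    IsPolyhedral (D.localSet i xi ∩ D.switchSet i s) := by
  have hcoupled := IsPolyhedral.setOf_forall_mem (isPolyhedral_setOf_h_nonpos (D := D) i)
  have hinput := IsPolyhedral.setOf_forall_mem fun k =>
    hU.isPolyhedral.preimage (D.inpMap i k).toAffineMap
  have hinitial := IsPolyhedral.setOf_eq (D.ownMap i 0).toAffineMap (AffineMap.const ℝ _ xi)
  have hterminal := hXT.isPolyhedral.preimage (D.ownMap i (Fin.last _)).toAffineMap
  convert (hcoupled.inter (hinput.inter (hinitial.inter hterminal))).inter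
    (isPolyhedral_switchSet i s) using 1
  have hX {y : D.LocVar i} (hy : y ∈ D.switchSet i s) (k) : LocVar.own y k ∈ S.X i :=
    S.iUnion_P i ▸ Set.mem_iUnion.2 ⟨_, hy.2 k⟩
  exact Set.ext fun y => and_congr_left fun hy => and_congr_right fun _ => and_iff_right (hX hy)

theorem isPolyhedral_consensusProblem_C (hU : ∀ i, IsPolyhedron (S.U i))
    (hXT : ∀ i, IsPolyhedron (D.XT i)) (hcost : D.CostAssumption) (x : S.State)
    (s : ∀ i, D.SwSeq i) : IsPolyhedral (D.consensusProblem hcost x s).C :=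
  IsPolyhedral.setOf_forall_mem fun i =>
    (isPolyhedral_localSet_inter_switchSet (hU i) (hXT i) (x i) (s i)).preimage
      (LinearMap.proj i : D.Var →ₗ[ℝ] D.LocVar i).toAffineMap

variable {x : S.State} {u : ∀ i, D.InpSeq i}

theorem IsSwADMM.exists_tendsto {s : ℕ → ∀ i, D.SwSeq i} {y : ℕ → D.Var}
    {z : ℕ → ∀ i, D.Traj i} {lam : ℕ → ∀ i, D.Aug i} (h : D.IsSwADMM x u s y z lam)
    (hcoupling : D.CouplingAssumption) (hcost : D.CostAssumption)
    (hU : ∀ i, IsPolyhedron (S.U i)) (hXT : ∀ i, IsPolyhedron (D.XT i)) (hx : x ∈ D.X0) :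
    ∃ y', Tendsto y atTop (𝓝 y') := by
  obtain ⟨y', hy'⟩ := (h.isADMM hcost).exists_tendsto isDefinite_consensusProblem
    (isPolyhedral_consensusProblem_C hU hXT hcost x _)
    (consensusProblem_inter_preimage.symm ▸ h.nonempty_feasibleSw hcoupling hx D.Tcut)
  simp only [add_comm D.Tcut] at hy'
  exact ⟨y', (tendsto_add_atTop_iff_nat D.Tcut).1 hy'⟩

theorem mem_switchSet_of_mem_evalSwitching {i : Fin M} {xi : S.St i} {y : D.LocVar i}
    {s : D.SwSeq i} (h0 : LocVar.own y 0 = xi)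
    (hdyn : ∀ k : Fin D.N, LocVar.own y k.succ = S.f i (LocVar.own y k.castSucc) (LocVar.inp y k)
      (fun j => LocVar.copy y j k.castSucc))
    (hs : s ∈ D.evalSwitching i xi y) : y ∈ D.switchSet i s := by
  obtain ⟨ξ, hξ0, hξP, hξ⟩ := hs
  simp only [(S.isPolyhedron_P i _).isClosed.closure_eq] at hξP
  have hown : ∀ k, LocVar.own y k = ξ k := by
    intro k
    induction k using Fin.induction with
    | zero => rw [h0, hξ0]
    | succ k ih => rw [hdyn, ih, hξ, S.aff_eq_f (hξP _)]
  exact ⟨fun k => by rw [hown, hown, hξ], fun k => by rw [hown]; exact hξP k⟩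

theorem weaklyFeasible_of_rollout_mem_feasible (h : D.rollout x u ∈ D.feasible x) :
    D.WeaklyFeasible x u := by
  constructor
  · have hregion (i : Fin M) (k) : ∃ l, LocVar.own (D.rollout x u i) k ∈ S.P i l := by
      simpa only [← S.iUnion_P, Set.mem_iUnion] using (h.1 i).2.1 k
    choose s hs using hregion
    exact ⟨s, fun i => ⟨LocVar.own (D.rollout x u i), rfl, fun k => subset_closure (hs i k),
      fun k => (rollout_dynamics i k).trans (S.aff_eq_f (hs i _) _ _).symm⟩⟩
  · exact fun s hs => ⟨_, fun i => ⟨h.1 i, mem_switchSet_of_mem_evalSwitching rfl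
      (rollout_dynamics i) (hs i)⟩, h.2.2⟩

variable (D) in
/-- The data that switching ADMM carries from one iteration to the next: switching sequences,
consensus variables and multipliers. -/
structure SwADMMState where
  s : ∀ i, D.SwSeq i
  z : ∀ i, D.Traj i
  lam : ∀ i, D.Aug i

/-- Iteration number `τ` of switching ADMM at `x` may lead from `p` to `p'` through the local
minimizers `y`. -/
structure IsSwADMMIteration (x : S.State) (τ : ℕ) (p : D.SwADMMState) (y : D.Var)
    (p' : D.SwADMMState) : Prop where
  y_mem : ∀ i, y i ∈ D.localSet i (x i) ∩ D.switchSet i (p.s i)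
  y_min : ∀ i, IsMinOn (D.localObj i (p.lam i) p.z)
    (D.localSet i (x i) ∩ D.switchSet i (p.s i)) (y i)
  z_eq : p'.z = D.average y
  lam_eq : ∀ i, p'.lam i = p.lam i + D.ρ • ((y i).1 - D.augOf p'.z i)
  s_switch : τ < D.Tcut → ∀ i, (D.evalSwitching i (x i) (y i) \ {p.s i}).Nonempty →
    p'.s i ∈ D.evalSwitching i (x i) (y i) \ {p.s i}
  s_keep : τ < D.Tcut → ∀ i, ¬ (D.evalSwitching i (x i) (y i) \ {p.s i}).Nonempty →
    p'.s i = p.s i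
  s_frozen : D.Tcut ≤ τ → p'.s = p.s

theorem IsSwADMMIteration.nonempty {τ : ℕ} {p p' : D.SwADMMState} {y : D.Var}
    (h : IsSwADMMIteration x τ p y p') (i : Fin M) :
    (D.localSet i (x i) ∩ D.switchSet i (p'.s i)).Nonempty := by
  obtain ⟨hlocal, hswitch⟩ := h.y_mem i
  refine ⟨y i, hlocal, ?_⟩
  rcases lt_or_ge τ D.Tcut with hτ | hτ
  · by_cases hne : (D.evalSwitching i (x i) (y i) \ {p.s i}).Nonempty
    · exact mem_switchSet_of_mem_evalSwitching hlocal.2.2.2.1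
        (fun k => (hswitch.1 k).trans (S.aff_eq_f (hswitch.2 _) _ _)) (h.s_switch hτ i hne).1
    · exact (h.s_keep hτ i hne).symm ▸ hswitch
  · exact (congrFun (h.s_frozen hτ) i).symm ▸ hswitch

theorem exists_isSwADMMIteration (hXT : ∀ i, IsClosed (D.XT i)) (hcost : D.CostAssumption)
    (τ : ℕ) {p : D.SwADMMState}
    (hp : ∀ i, (D.localSet i (x i) ∩ D.switchSet i (p.s i)).Nonempty) :
    ∃ y p', IsSwADMMIteration x τ p y p' := by
  classical
  choose y₀ hy₀ using hp
  obtain ⟨y, hy, hmin⟩ := isDefinite_consensusProblem.exists_isMinOn_augLagrangian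
    (isClosed_consensusProblem_C hXT hcost x p.s) ⟨y₀, hy₀⟩ p.lam
    (z := D.augOfMap p.z) ⟨p.z, rfl⟩
  refine ⟨y, ⟨fun i => if h : τ < D.Tcut ∧ (D.evalSwitching i (x i) (y i) \ {p.s i}).Nonempty
    then h.2.some else p.s i, D.average y,
    fun i => p.lam i + D.ρ • ((y i).1 - D.augOf (D.average y) i)⟩, hy,
    (isMinOn_augLagrangian_consensusProblem_iff hy).1 hmin, rfl, fun _ => rfl,
    fun hτ i hne => ?_, fun _ i hne => ?_, fun hτ => funext fun i => ?_⟩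
  · simp only [dif_pos (And.intro hτ hne)]
    exact hne.some_mem
  · exact dif_neg fun h => hne h.2
  · exact dif_neg fun h => hτ.not_gt h.1

theorem WeaklyFeasible.exists_isSwADMM (h : D.WeaklyFeasible x u) (hXT : ∀ i, IsClosed (D.XT i))
    (hcost : D.CostAssumption) : ∃ s y z lam, D.IsSwADMM x u s y z lam := by
  obtain ⟨⟨s₀, hs₀⟩, hne⟩ := h
  obtain ⟨y₀, hy₀⟩ := hne s₀ hs₀
  have hiterate (τ : ℕ) (p : {p : D.SwADMMState //
      ∀ i, (D.localSet i (x i) ∩ D.switchSet i (p.s i)).Nonempty}) :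
      ∃ y p', IsSwADMMIteration x τ p.1 y p' := exists_isSwADMMIteration hXT hcost τ p.2
  choose y next hnext using hiterate
  let p (τ : ℕ) : {p : D.SwADMMState //
      ∀ i, (D.localSet i (x i) ∩ D.switchSet i (p.s i)).Nonempty} :=
    Nat.rec ⟨⟨s₀, 0, 0⟩, fun i => ⟨y₀ i, hy₀.1 i⟩⟩
      (fun τ p => ⟨next τ p, (hnext τ p).nonempty⟩) τ
  have hp (τ : ℕ) : IsSwADMMIteration x τ (p τ).1 (y τ (p τ)) (p (τ + 1)).1 := hnext τ (p τ)
  exact ⟨fun τ => (p τ).1.s, fun τ => y τ (p τ), fun τ => (p τ).1.z, fun τ => (p τ).1.lam,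
    { z_zero := rfl
      lam_zero := rfl
      s_zero := hs₀
      y_mem := fun τ => (hp τ).y_mem
      y_min := fun τ => (hp τ).y_min
      z_succ := fun τ => congrFun (hp τ).z_eq
      lam_succ := fun τ => (hp τ).lam_eq
      s_switch := fun τ => (hp τ).s_switch
      s_keep := fun τ => (hp τ).s_keep
      s_frozen := fun τ => (hp τ).s_frozen }⟩

/-- The loop states that keep the controller going: a terminal state, a feasible state with a
weakly feasible guess at hand. -/
def IsOperational (u0 : ∀ i, D.InpSeq i) (σ : D.LoopState) : Prop :=
  σ.1 ∈ D.XTglobal ∨ σ.1 ∈ D.X0 ∧ ∃ u, D.IsGuess u0 σ.2 u ∧ D.WeaklyFeasible σ.1 u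

variable {u0 : ∀ i, D.InpSeq i} {σ σ' : D.LoopState}

theorem isOperational_planState (hterminal : D.TerminalAssumption)
    (hu : D.rollout x u ∈ D.feasible x) : IsOperational u0 (D.planState x u) := by
  obtain ⟨v, hv⟩ := exists_isShiftedGuess ((rollout_mem_feasible_iff.1 hu).1 D.N le_rfl)
  exact Or.inr ⟨hterminal.next_mem_X0 hu, v, hv,
    weaklyFeasible_of_rollout_mem_feasible (hv.rollout_mem_feasible hterminal hu)⟩

theorem IsOperational.step (h : IsOperational u0 σ) (hcoupling : D.CouplingAssumption)
    (hterminal : D.TerminalAssumption) (hcost : D.CostAssumption) (hstep : D.Step u0 σ σ') :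
    IsOperational u0 σ' := by
  by_cases hσ : σ.1 ∈ D.XTglobal
  · obtain ⟨w, hw, hnext⟩ := hstep.exists_terminalInput hσ
    exact Or.inl (hnext ▸ hterminal.next_mem hσ hw)
  · obtain ⟨-, u, -, hu, rfl, -⟩ :=
      hstep.exists_planState hcoupling hterminal.isClosed hcost hσ (h.resolve_left hσ).1
    exact isOperational_planState hterminal hu

theorem IsOperational.exists_step (h : IsOperational u0 σ) (hcoupling : D.CouplingAssumption)
    (hterminal : D.TerminalAssumption) (hcost : D.CostAssumption)
    (hU : ∀ i, IsPolyhedron (S.U i)) (hXT : ∀ i, IsPolyhedron (D.XT i)) :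
    ∃ σ', D.Step u0 σ σ' := by
  by_cases hσ : σ.1 ∈ D.XTglobal
  · obtain ⟨-, l, hl, -⟩ := D.exists_isTerminalInput fun i => hterminal.subset_X i (hσ i)
    exact ⟨(S.next σ.1 _, σ.2), Or.inl ⟨hσ, rfl, l, hl, rfl⟩⟩
  · obtain ⟨hX0, u, hguess, hu⟩ := h.resolve_left hσ
    obtain ⟨s, y, z, lam, hrun⟩ := hu.exists_isSwADMM hterminal.isClosed hcost
    obtain ⟨y', hlim⟩ := hrun.exists_tendsto hcoupling hcost hU hXT hX0
    exact ⟨(_, some _), Or.inr ⟨hσ, u, _, hguess, ⟨y', ⟨s, y, z, lam, hrun, hlim⟩, rfl⟩, rfl, rfl⟩⟩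

theorem wellPosed (hcoupling : D.CouplingAssumption) (hterminal : D.TerminalAssumption)
    (hcost : D.CostAssumption) (hU : ∀ i, IsPolyhedron (S.U i))
    (hXT : ∀ i, IsPolyhedron (D.XT i)) : D.WellPosed := by
  intro x0 u0 hinit σ hreach
  have hσ : IsOperational u0 σ := by
    induction hreach with
    | refl => exact or_iff_not_imp_left.2 fun hx0 => ⟨hinit.1, u0, rfl, hinit.2 hx0⟩
    | tail _ hstep ih => exact ih.step hcoupling hterminal hcost hstep
  exact ⟨hσ.exists_step hcoupling hterminal hcost hU hXT, fun hσT _ _ _ _ _ _ hrun =>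
    hrun.exists_tendsto hcoupling hcost hU hXT (hσ.resolve_left hσT).1⟩

end MPCDesign

end

theorem theorem2_general {M : ℕ} (S : PWANetwork M) (D : MPCDesign S)
    (hcoupling : D.CouplingAssumption) (hterminal : D.TerminalAssumption)
    (hcost : D.CostAssumption) :
    D.ExponentiallyStabilizing ∧
      ((∀ i, IsPolyhedron (S.U i)) → (∀ i, IsPolyhedron (D.XT i)) → D.WellPosed) :=
  ⟨MPCDesign.exponentiallyStabilizing hcoupling hterminal hcost,
    MPCDesign.wellPosed hcoupling hterminal hcost⟩

theorem theorem2 {M : ℕ} (S : PWANetwork M) (D : MPCDesign S)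
    (hcoupling : D.CouplingAssumption) (hsystem : D.SystemAssumption)
    (hterminal : D.TerminalAssumption) (hcost : D.CostAssumption) :
    D.ExponentiallyStabilizing ∧
      ((∀ i, IsPolyhedron (S.U i)) → (∀ i, IsPolyhedron (D.XT i)) → D.WellPosed) :=
  theorem2_general S D hcoupling hterminal hcost
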